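/- **Theorem 1.5.** All graphs are finite and simple. A *signed graph* $\widehat G=(G,\sigma)$ is a graph $G$ with a signature $\sigma:E(G)\to\{+,-\}$. *Switching* at a vertex $v$ reverses the signs of the edges incident with $v$; $(G,\sigma)$ is *balanced* if a finite sequence of vertex switchings makes all its edges positive, and a vertex set $X$ is *balanced* in $(G,\sigma)$ if the induced signed graph $(G[X],\sigma|_{G[X]})$ is balanced. Given a positive integer $p$ and $\phi:V(G)\to\{1,\dots,p\}$, a *$(p,\phi)$-coloring* of $\widehat G$ assigns to every vertex $v$ a set of exactly $\phi(v)$ of the $p$ colors in such a way that for each color the set of vertices that receive it is balanced. A *block* of $G$ is a maximal $2$-connected subgraph of $G$, where a graph is $2$-connected if it has at least three vertices, is connected and remains connected after the deletion of any one vertex. A block is *of type $C_3^*$* if it is a triangle $xyz$ with $d_G(x)=d_G(y)=2$ and $d_G(z)\le 3$, and *of type $C_4^*$* if it is a $4$-cycle $xyzw$ with $d_G(x)=d_G(y)=d_G(z)=2$ and $d_G(w)\le 3$ (degrees in $G$, not in the block). $K_4^\bullet$ is the graph obtained from $K_4$ by subdividing one edge exactly once. Let $\widehat G=(G,\sigma)$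 be a connected signed graph with at least two vertices in which every vertex has degree at most $3$. Suppose that no block of $G$ is of type $C_3^*$ or $C_4^*$ or isomorphic to $K_4^\bullet$ or $K_4$. Then $\widehat G$ admits a $(5,\phi)$-coloring with $\phi(v)=6-d_G(v)$ for every $v\in V(G)$. -/

import Mathlib

/-- A signature on a graph `G`: each edge gets a sign `1` or `-1`.
The pair `(G, σ)` is a signed graph with underlying simple graph `G`. -/
abbrev Signature {V : Type*} (G : SimpleGraph V) : Type _ := G.edgeSet → ℤˣ

namespace Signature

/-- Vertex switching at `v`: the signs of exactly the edges incident with `v` are reversed. -/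
noncomputable def switchAt {V : Type*} {G : SimpleGraph V} (σ : Signature G) (v : V) :
    Signature G :=
  open Classical in fun e => if v ∈ (e : Sym2 V) then -σ e else σ e

/-- Two signatures are switching equivalent if the second is obtained from the first by a
finite sequence of vertex switchings. -/
def SwitchingEquivalent {V : Type*} {G : SimpleGraph V} (σ τ : Signature G) : Prop :=
  Relation.ReflTransGen (fun α β : Signature G => ∃ v : V, β = α.switchAt v) σ τ

/-- A signed graph is balanced if it is switching equivalent to the all-positive one. -/
def IsBalanced {V : Type*} {G : SimpleGraph V} (σ : Signature G) : Prop :=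
  σ.SwitchingEquivalent (fun _ => 1)

/-- The restriction of a signature to the subgraph induced on a vertex set `X`. -/
def restrict {V : Type*} {G : SimpleGraph V} (σ : Signature G) (X : Set V) :
    Signature (G.induce X) :=
  fun e => σ ((SimpleGraph.Embedding.induce X).mapEdgeSet e)

/-- A vertex set is balanced if the signed subgraph induced on it is balanced. -/
def IsBalancedSet {V : Type*} {G : SimpleGraph V} (σ : Signature G) (X : Set V) : Prop :=
  (σ.restrict X).IsBalanced

/-- `f` is a balanced `(p, φ)`-coloring of `(G, σ)`: every vertex `v` gets a set of `φ v` of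
the `p` colors, and for each color the set of vertices that have it is balanced. -/
def IsColoring {V : Type*} {G : SimpleGraph V} (σ : Signature G) (p : ℕ) (φ : V → ℕ)
    (f : V → Finset (Fin p)) : Prop :=
  (∀ v, (f v).card = φ v) ∧ ∀ i : Fin p, σ.IsBalancedSet {v | i ∈ f v}

end Signature

/-- A graph is 2-connected if it has at least three vertices, is connected, and stays connected
after the deletion of any one vertex. -/
def IsTwoConnected {W : Type*} (H : SimpleGraph W) : Prop :=
  3 ≤ ENat.card W ∧ H.Connected ∧ ∀ w : W, (H.induce {w}ᶜ).Connected

/-- A block of `G` is a maximal 2-connected subgraph of `G`. -/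
def IsBlock {V : Type*} {G : SimpleGraph V} (B : G.Subgraph) : Prop :=
  Maximal (fun H : G.Subgraph => IsTwoConnected H.coe) B

/-- `B` is a triangle of `G` with two vertices of degree 2 in `G`, the third one having degree
at most 3 in `G`. -/
def IsC3Star {V : Type*} {G : SimpleGraph V} [G.LocallyFinite] (B : G.Subgraph) : Prop :=
  ∃ c : SimpleGraph.cycleGraph 3 ≃g B.coe,
    G.degree (c 0) = 2 ∧ G.degree (c 1) = 2 ∧ G.degree (c 2) ≤ 3

/-- `B` is a 4-cycle of `G` with three vertices of degree 2 in `G`, the fourth one having degree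
at most 3 in `G`. -/
def IsC4Star {V : Type*} {G : SimpleGraph V} [G.LocallyFinite] (B : G.Subgraph) : Prop :=
  ∃ c : SimpleGraph.cycleGraph 4 ≃g B.coe,
    G.degree (c 0) = 2 ∧ G.degree (c 1) = 2 ∧ G.degree (c 2) = 2 ∧ G.degree (c 3) ≤ 3

/-- The graph obtained from the complete graph on `0, 1, 2, 3` by subdividing the edge `01`
once, the new vertex being `4`. -/
def K4Bullet : SimpleGraph (Fin 5) :=
  SimpleGraph.fromEdgeSet
    {s(0, 2), s(0, 3), s(1, 2), s(1, 3), s(2, 3), s(0, 4), s(4, 1)}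

/-! A vertex of degree d receives 6 - d of the five colors, so it misses d - 1 of them. It is enough
that every color class induces a forest, because a forest is balanced under any signature
(`Signature.isBalanced_of_forall_not_isCore`). A finite graph is a forest exactly when it has no
core. The signs therefore drop out, and the task is to distribute the missing colors, two at
vertices of degree 3 and one at vertices of degree 2, so that every core meets each of the five:
`CoreColorable`.

For induction the degree condition is replaced by a set `S` of vertices allowed two missing colors.
`S` contains all vertices of degree 3 but may contain others. The forbidden configurations of
`Admissible` have too few slots: a triangle with two vertices outside `S` has at most 4, a 4-cycle
outside `S` has 4, and in `K4` and `K4Bullet` every color needs two vertices, hence 10 slots, while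
at most 8 and, if the subdividing vertex is outside `S`, at most 9 are available.

A counterexample with minimal support is shown not to exist. Vertices of degree at most 2 go first:
a triangle through one is colored by hand, and otherwise the vertex is suppressed, its neighbors
borrowing its slots (`CoreColorable.of_bypass_singleton`). The few graphs in which suppression
creates an obstruction are colored explicitly. What remains is cubic apart from isolated vertices.
There a vertex `u` is deleted, one neighbor `z` is suppressed, and the other two neighbors are
restricted to one color (`CoreColorable.of_bypass_pair`). A new obstruction would contain either a
triangle through those two neighbors or a diamond avoiding them. Suitable choices of `u` and `z`
exclude in turn diamonds, triangles and K_{2,3}, after which any choice gives a contradiction. -/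

namespace SimpleGraph

variable {V : Type*}

/-! ### Cores, admissible pairs and the two reductions. -/

/-- A nonempty vertex set in which every vertex has at least two neighbours inside the set. -/
def IsCore (G : SimpleGraph V) (X : Set V) : Prop :=
  X.Nonempty ∧ ∀ v ∈ X, ∃ a ∈ X, ∃ b ∈ X, a ≠ b ∧ G.Adj v a ∧ G.Adj v b

/-- Every core of `G` meets every colour class of `c`. -/
def CoresSeeAll (G : SimpleGraph V) (c : V → Finset (Fin 5)) : Prop :=
  ∀ X, G.IsCore X → ∀ i, ∃ x ∈ X, i ∈ c x

/-- There is an assignment of at most two of five colours to each vertex, and at most one to the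
vertices outside `S`, such that every core of `G` sees all five colours. -/
def CoreColorable (G : SimpleGraph V) (S : Set V) : Prop :=
  ∃ c : V → Finset (Fin 5), (∀ v, (c v).card ≤ 2) ∧ (∀ v ∉ S, (c v).card ≤ 1) ∧ G.CoresSeeAll c

/-- The vertices `a, b, c, d, e` span a copy of `K4` in which `e` subdivides the edge `ab`. -/
structure IsK4Bullet (G : SimpleGraph V) (a b c d e : V) : Prop where
  ne_ab : a ≠ b
  ne_ec : e ≠ c
  ne_ed : e ≠ d
  ac : G.Adj a c
  ad : G.Adj a d
  bc : G.Adj b c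
  bd : G.Adj b d
  cd : G.Adj c d
  ea : G.Adj e a
  eb : G.Adj e b

/-- A subcubic graph whose vertices outside `S` have degree at most two and which contains none of
the four obstructions to `CoreColorable`. -/
structure Admissible (G : SimpleGraph V) (S : Set V) : Prop where
  deg_le_three : ∀ v, (G.neighborSet v).ncard ≤ 3
  deg_le_two : ∀ v ∉ S, (G.neighborSet v).ncard ≤ 2
  triangle : ∀ a b c, G.Adj a b → G.Adj a c → G.Adj b c → a ∉ S → b ∉ S → False
  square : ∀ a b c d, G.Adj a b → G.Adj b c → G.Adj c d → G.Adj d a → a ≠ c → b ≠ d →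
    a ∉ S → b ∉ S → c ∉ S → d ∉ S → False
  k4 : ∀ a b c d, G.Adj a b → G.Adj a c → G.Adj a d → G.Adj b c → G.Adj b d → G.Adj c d → False
  k4Bullet : ∀ a b c d e, G.IsK4Bullet a b c d e → e ∈ S

/-- The graph `G` with all edges meeting `W` removed. -/
def isolate (G : SimpleGraph V) (W : Set V) : SimpleGraph V where
  Adj a b := G.Adj a b ∧ a ∉ W ∧ b ∉ W
  symm := ⟨fun _ _ h => ⟨h.1.symm, h.2.2, h.2.1⟩⟩
  loopless := ⟨fun _ h => G.irrefl h.1⟩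

/-- The graph `G` with all edges meeting `W` removed and the edge `pq` added. -/
def bypass (G : SimpleGraph V) (W : Set V) (p q : V) : SimpleGraph V :=
  G.isolate W ⊔ edge p q

theorem isolate_adj {G : SimpleGraph V} {W : Set V} {a b : V} :
    (G.isolate W).Adj a b ↔ G.Adj a b ∧ a ∉ W ∧ b ∉ W := Iff.rfl

theorem bypass_adj {G : SimpleGraph V} {W : Set V} {p q a b : V} (hpq : p ≠ q) :
    (G.bypass W p q).Adj a b ↔
      (G.Adj a b ∧ a ∉ W ∧ b ∉ W) ∨ (a = p ∧ b = q ∨ a = q ∧ b = p) := by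
  simp only [bypass, sup_adj, isolate_adj, edge_adj]
  constructor
  · rintro (h | ⟨h, -⟩)
    · exact Or.inl h
    · exact Or.inr h
  · rintro (h | h)
    · exact Or.inl h
    · refine Or.inr ⟨h, ?_⟩
      rcases h with ⟨rfl, rfl⟩ | ⟨rfl, rfl⟩
      · exact hpq
      · exact hpq.symm

theorem isolate_le (G : SimpleGraph V) (W : Set V) : G.isolate W ≤ G := fun _ _ h => h.1

theorem support_isolate_ssubset {G : SimpleGraph V} {W : Set V} {v : V} (hv : v ∈ W)
    (hvs : v ∈ G.support) : (G.isolate W).support ⊂ G.support := by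
  refine ⟨support_mono (G.isolate_le W), fun h => ?_⟩
  obtain ⟨w, hw⟩ := h hvs
  exact hw.2.1 hv

theorem support_bypass_ssubset {G : SimpleGraph V} {W : Set V} {p q v : V} (hpq : p ≠ q)
    (hp : p ∈ G.support) (hq : q ∈ G.support) (hpW : p ∉ W) (hqW : q ∉ W) (hv : v ∈ W)
    (hvs : v ∈ G.support) : (G.bypass W p q).support ⊂ G.support := by
  refine ⟨?_, fun h => ?_⟩
  · rintro w ⟨t, ht⟩
    rcases (bypass_adj hpq).1 ht with h | ⟨rfl, -⟩ | ⟨rfl, -⟩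
    · exact ⟨t, h.1⟩
    · exact hp
    · exact hq
  · obtain ⟨w, hw⟩ := h hvs
    rcases (bypass_adj hpq).1 hw with h | ⟨rfl, -⟩ | ⟨rfl, -⟩
    · exact h.2.1 hv
    · exact hpW hv
    · exact hqW hv

section Neighbors

variable [Finite V] {G : SimpleGraph V} {v p q r : V}

theorem eq_or_eq_of_adj (h : (G.neighborSet v).ncard ≤ 2) (hp : G.Adj v p) (hq : G.Adj v q)
    (hpq : p ≠ q) : ∀ w, G.Adj v w → w = p ∨ w = q := by
  intro w hw
  have hs : ({p, q} : Set V) ⊆ G.neighborSet v := by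
    rintro x (rfl | rfl) <;> assumption
  have := Set.eq_of_subset_of_ncard_le hs (by rwa [Set.ncard_pair hpq])
  have hw' : w ∈ G.neighborSet v := hw
  rw [← this] at hw'
  simpa using hw'

theorem eq_or_eq_or_eq_of_adj (h : (G.neighborSet v).ncard ≤ 3) (hp : G.Adj v p) (hq : G.Adj v q)
    (hr : G.Adj v r) (hpq : p ≠ q) (hpr : p ≠ r) (hqr : q ≠ r) :
    ∀ w, G.Adj v w → w = p ∨ w = q ∨ w = r := by
  intro w hw
  have hs : ({p, q, r} : Set V) ⊆ G.neighborSet v := by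
    rintro x (rfl | rfl | rfl) <;> assumption
  have := Set.eq_of_subset_of_ncard_le hs
    (by rwa [Set.ncard_eq_three.2 ⟨p, q, r, hpq, hpr, hqr, rfl⟩])
  have hw' : w ∈ G.neighborSet v := hw
  rw [← this] at hw'
  simpa using hw'

theorem not_ncard_le_two (hp : G.Adj v p) (hq : G.Adj v q) (hr : G.Adj v r)
    (hpq : p ≠ q) (hpr : p ≠ r) (hqr : q ≠ r) : ¬ (G.neighborSet v).ncard ≤ 2 := by
  intro h
  rcases eq_or_eq_of_adj h hp hq hpq r hr with rfl | rfl
  · exact hpr rfl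
  · exact hqr rfl

theorem exists_third_of_adj (h : (G.neighborSet v).ncard ≤ 3) (hp : G.Adj v p) (hq : G.Adj v q)
    (hpq : p ≠ q) : ∃ r, ∀ w, G.Adj v w → w = p ∨ w = q ∨ w = r := by
  by_cases h' : ∃ r, G.Adj v r ∧ r ≠ p ∧ r ≠ q
  · obtain ⟨r, hr, h1, h2⟩ := h'
    exact ⟨r, eq_or_eq_or_eq_of_adj h hp hq hr hpq h1.symm h2.symm⟩
  -- Without a third neighbor the value is irrelevant, and `p` is repeated.
  · refine ⟨p, fun w hw => ?_⟩
    by_contra! hc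
    exact h' ⟨w, hw, hc.1, hc.2.1⟩

end Neighbors

namespace IsCore

variable {G : SimpleGraph V} {X : Set V} {v p q r : V}

theorem mem_of_two (hX : G.IsCore X) (hN : ∀ w, G.Adj v w → w = p ∨ w = q) (hv : v ∈ X) :
    p ∈ X ∧ q ∈ X := by
  obtain ⟨a, ha, b, hb, hab, h1, h2⟩ := hX.2 v hv
  rcases hN a h1 with rfl | rfl <;> rcases hN b h2 with rfl | rfl <;> simp_all

theorem mem_of_three (hX : G.IsCore X) (hN : ∀ w, G.Adj v w → w = p ∨ w = q ∨ w = r)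
    (hv : v ∈ X) : (p ∈ X ∧ q ∈ X) ∨ (p ∈ X ∧ r ∈ X) ∨ (q ∈ X ∧ r ∈ X) := by
  obtain ⟨a, ha, b, hb, hab, h1, h2⟩ := hX.2 v hv
  rcases hN a h1 with rfl | rfl | rfl <;> rcases hN b h2 with rfl | rfl | rfl <;> simp_all

theorem isolate (hX : G.IsCore X) {W : Set V} (h : ∀ v ∈ W, v ∉ X) : (G.isolate W).IsCore X := by
  refine ⟨hX.1, fun v hv => ?_⟩
  obtain ⟨a, ha, b, hb, hab, h1, h2⟩ := hX.2 v hv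
  exact ⟨a, ha, b, hb, hab, ⟨h1, fun h' => h _ h' hv, fun h' => h _ h' ha⟩,
    ⟨h2, fun h' => h _ h' hv, fun h' => h _ h' hb⟩⟩

/-- Removing from a core a vertex with at most the two neighbours `p`, `q` in it leaves a core
once `p` and `q` are joined. -/
theorem bypass (hX : G.IsCore X) {D : Set V} (hD : ∀ v ∈ D, v ∉ X) {z : V}
    (hz : ∀ w, G.Adj z w → w ∈ D ∨ w = p ∨ w = q) (hpq : p ≠ q) (hadj : ¬ G.Adj p q)
    (hpz : p ≠ z) (hqz : q ≠ z) :
    (G.bypass (insert z D) p q).IsCore (X \ {z}) := by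
  have hzX : z ∈ X → p ∈ X ∧ q ∈ X := by
    intro h
    obtain ⟨a, ha, b, hb, hab, h1, h2⟩ := hX.2 z h
    rcases hz a h1 with h' | rfl | rfl
    · exact absurd ha (hD _ h')
    all_goals
      rcases hz b h2 with h' | rfl | rfl
      · exact absurd hb (hD _ h')
      all_goals simp_all
  refine ⟨?_, ?_⟩
  · by_cases h : z ∈ X
    · exact ⟨p, (hzX h).1, hpz⟩
    · obtain ⟨x, hx⟩ := hX.1
      exact ⟨x, hx, fun h' => h (by rw [← Set.mem_singleton_iff.1 h']; exact hx)⟩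
  · rintro v ⟨hv, hvz⟩
    have hvz : v ≠ z := hvz
    have key : ∀ a b, a ∈ X → b ∈ X → a ≠ b → G.Adj v a → G.Adj v b → b ≠ z →
        ∃ a ∈ X \ {z}, ∃ b ∈ X \ {z}, a ≠ b ∧ (G.bypass (insert z D) p q).Adj v a ∧
          (G.bypass (insert z D) p q).Adj v b := by
      intro a b ha hb hab h1 h2 hbz
      simp only [bypass_adj hpq, Set.mem_sdiff, Set.mem_singleton_iff, Set.mem_insert_iff]
      have hvD : v ∉ D := fun h => hD v h hv
      have haD : a ∉ D := fun h => hD a h ha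
      have hbD : b ∉ D := fun h => hD b h hb
      -- If `v` loses its neighbor `z`, then `v` is `p` or `q` and the new edge leads to the other
      -- one. This differs from `b` because `p` and `q` are not adjacent in `G`.
      by_cases haz : a = z
      · subst haz
        obtain ⟨hp, hq⟩ := hzX ha
        rcases hz v h1.symm with h | rfl | rfl
        · exact absurd h hvD
        · exact ⟨q, ⟨hq, hqz⟩, b, ⟨hb, hbz⟩, fun h => hadj (h ▸ h2), by simp,
            Or.inl ⟨h2, by simp [hvz, hvD], by simp [hbz, hbD]⟩⟩
        · exact ⟨p, ⟨hp, hpz⟩, b, ⟨hb, hbz⟩, fun h => hadj (h ▸ h2.symm), by simp,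
            Or.inl ⟨h2, by simp [hvz, hvD], by simp [hbz, hbD]⟩⟩
      · exact ⟨a, ⟨ha, haz⟩, b, ⟨hb, hbz⟩, hab, Or.inl ⟨h1, by simp [hvz, hvD], by simp [haz, haD]⟩,
          Or.inl ⟨h2, by simp [hvz, hvD], by simp [hbz, hbD]⟩⟩
    obtain ⟨a, ha, b, hb, hab, h1, h2⟩ := hX.2 v hv
    by_cases hbz : b = z
    · exact key b a hb ha hab.symm h2 h1 (fun h => hab (h.trans hbz.symm))
    · exact key a b ha hb hab h1 h2 hbz

end IsCore

theorem Admissible.isolate [Finite V] {G : SimpleGraph V} {S : Set V} (h : G.Admissible S)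
    (W : Set V) : (G.isolate W).Admissible S := by
  have hs : ∀ v, ((G.isolate W).neighborSet v).ncard ≤ (G.neighborSet v).ncard := fun v =>
    Set.ncard_le_ncard (fun w hw => hw.1)
  refine ⟨fun v => (hs v).trans (h.1 v), fun v hv => (hs v).trans (h.2 v hv), ?_, ?_, ?_, ?_⟩
  · intro a b c h1 h2 h3
    exact h.triangle a b c h1.1 h2.1 h3.1
  · intro a b c d h1 h2 h3 h4
    exact h.square a b c d h1.1 h2.1 h3.1 h4.1
  · intro a b c d h1 h2 h3 h4 h5 h6
    exact h.k4 a b c d h1.1 h2.1 h3.1 h4.1 h5.1 h6.1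
  · rintro a b c d e ⟨h1, h2, h3, h4, h5, h6, h7, h8, h9, h10⟩
    exact h.k4Bullet a b c d e ⟨h1, h2, h3, h4.1, h5.1, h6.1, h7.1, h8.1, h9.1, h10.1⟩

/-- Enlarging the color sets preserves the condition on cores, so they may be padded to full size.
-/
theorem CoreColorable.exists_card_eq {G : SimpleGraph V} {S : Set V} (h : G.CoreColorable S) :
    ∃ c : V → Finset (Fin 5), (∀ v ∈ S, (c v).card = 2) ∧ (∀ v ∉ S, (c v).card = 1) ∧
      G.CoresSeeAll c := by
  classical
  obtain ⟨c, h2, h1, hc⟩ := h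
  have : ∀ v, ∃ t, c v ⊆ t ∧ t.card = if v ∈ S then 2 else 1 := by
    intro v
    refine Finset.exists_superset_card_eq ?_ ?_
    · split_ifs with hv
      · exact h2 v
      · exact h1 v hv
    · split_ifs <;> simp
  choose t ht htc using this
  refine ⟨t, fun v hv => by simp [htc, hv], fun v hv => by simp [htc, hv], fun X hX i => ?_⟩
  obtain ⟨x, hx, hi⟩ := hc X hX i
  exact ⟨x, hx, ht x hi⟩

/-- A colouring of the vertices in `W` such that every core meeting `W` sees all colours inside
`W` can be completed by any colouring of the rest. -/
theorem CoreColorable.of_isolate {G : SimpleGraph V} {S W : Set V}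
    (h : (G.isolate W).CoreColorable S) (d : V → Finset (Fin 5)) (h2 : ∀ v, (d v).card ≤ 2)
    (h1 : ∀ v ∉ S, v ∈ W → (d v).card ≤ 1)
    (hd : ∀ X, G.IsCore X → ∀ i, (∀ x ∈ W, i ∈ d x → x ∉ X) → ∀ x ∈ W, x ∉ X) :
    G.CoreColorable S := by
  classical
  obtain ⟨c, hc2, hc1, hc⟩ := h
  refine ⟨fun v => if v ∈ W then d v else c v, ?_, ?_, ?_⟩
  · intro v
    dsimp only
    split_ifs
    exacts [h2 v, hc2 v]
  · intro v hv
    dsimp only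
    split_ifs with hW
    exacts [h1 v hv hW, hc1 v hv]
  · intro X hX i
    by_contra! hcon
    have hW := hd X hX i fun x hxW hi hx => hcon x hx (by simpa [hxW] using hi)
    obtain ⟨x, hx, hi⟩ := hc X (hX.isolate hW) i
    exact hcon x hx (by simpa [show x ∉ W from fun h => hW x h hx] using hi)

end SimpleGraph
-- Configurations colored separately from the rest.
namespace SimpleGraph

variable {V : Type*} [Finite V] {G : SimpleGraph V} {S : Set V}

theorem Admissible.mem_of_three (h : G.Admissible S) {v p q r : V} (hp : G.Adj v p)
    (hq : G.Adj v q) (hr : G.Adj v r) (hpq : p ≠ q) (hpr : p ≠ r) (hqr : q ≠ r) : v ∈ S := by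
  by_contra hv
  exact not_ncard_le_two hp hq hr hpq hpr hqr (h.deg_le_two v hv)

/-- A vertex of degree at most one lies in no core, so it needs no color. -/
theorem CoreColorable.of_isolate_singleton {v : V} (h : (G.isolate {v}).CoreColorable S)
    (hv : (G.neighborSet v).ncard ≤ 1) : G.CoreColorable S := by
  refine h.of_isolate (fun _ => ∅) (by simp) (by simp) ?_
  rintro X hX i - x rfl hx
  obtain ⟨a, ha, b, hb, hab, h1, h2⟩ := hX.2 x hx
  exact hab ((Set.ncard_le_one).1 hv a h1 b h2)

/-- A `K4Bullet` whose vertex of degree two is in `S` can be coloured independently of the rest. -/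
theorem CoreColorable.of_isolate_k4Bullet (hG : G.Admissible S) {a b c d e : V}
    (hK : G.IsK4Bullet a b c d e) (h : (G.isolate {a, b, c, d, e}).CoreColorable S) :
    G.CoreColorable S := by
  classical
  obtain ⟨hab, hec, hed, hac, had, hbc, hbd, hcd, hea, heb⟩ := id hK
  have heS := hG.k4Bullet _ _ _ _ _ hK
  have haS := hG.mem_of_three hac had hea.symm hcd.ne hec.symm hed.symm
  have hbS := hG.mem_of_three hbc hbd heb.symm hcd.ne hec.symm hed.symm
  have hcS := hG.mem_of_three hac.symm hbc.symm hcd hab had.ne hbd.ne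
  have hdS := hG.mem_of_three had.symm hbd.symm hcd.symm hab hac.ne hbc.ne
  have Na := eq_or_eq_or_eq_of_adj (hG.1 a) hac had hea.symm hcd.ne hec.symm hed.symm
  have Nb := eq_or_eq_or_eq_of_adj (hG.1 b) hbc hbd heb.symm hcd.ne hec.symm hed.symm
  have Nc := eq_or_eq_or_eq_of_adj (hG.1 c) hac.symm hbc.symm hcd hab had.ne hbd.ne
  have Nd := eq_or_eq_or_eq_of_adj (hG.1 d) had.symm hbd.symm hcd.symm hab hac.ne hbc.ne
  obtain ⟨r, Ne⟩ := exists_third_of_adj (hG.1 e) hea heb hab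
  -- All ten slots are used: each color sits on two vertices whose removal leaves a forest. This
  -- forest is joined to the rest by at most the one edge from `e` to `r`, so no core avoiding the
  -- color meets it.
  let f : V → Finset (Fin 5) := fun v =>
    if v = a then {2, 4} else if v = b then {3, 4} else if v = c then {0, 2} else
      if v = d then {1, 3} else {0, 1}
  have fa : f a = {2, 4} := by simp [f]
  have fb : f b = {3, 4} := by simp [f, hab.symm]
  have fc : f c = {0, 2} := by simp [f, hac.ne', hbc.ne']
  have fd : f d = {1, 3} := by simp [f, had.ne', hbd.ne', hcd.ne']
  have fe : f e = {0, 1} := by simp [f, hea.ne, heb.ne, hec, hed]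
  refine h.of_isolate f ?_ ?_ ?_
  · intro v
    simp only [f]
    split_ifs <;> decide
  · rintro v hv (rfl | rfl | rfl | rfl | rfl) <;> contradiction
  · intro X hX i hi
    have ma := hX.mem_of_three Na
    have mb := hX.mem_of_three Nb
    have mc := hX.mem_of_three Nc
    have md := hX.mem_of_three Nd
    have me := hX.mem_of_three Ne
    simp only [Set.mem_insert_iff, Set.mem_singleton_iff, forall_eq_or_imp, forall_eq,
      fa, fb, fc, fd, fe] at hi ⊢
    clear * - ma mb mc md me hi
    fin_cases i <;> simp at hi <;> grind

/-- A component that is a copy of `K4` with two adjacent edges `ab`, `ac` subdivided by `u`, `w`. -/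
theorem CoreColorable.of_isolate_subdivided_path (hG : G.Admissible S) {a b c d u w : V}
    (h : (G.isolate {a, b, c, d, u, w}).CoreColorable S) (hua : G.Adj u a) (hub : G.Adj u b)
    (hwa : G.Adj w a) (hwc : G.Adj w c) (had : G.Adj a d) (hbc : G.Adj b c) (hbd : G.Adj b d)
    (hcd : G.Adj c d) (hab : a ≠ b) (hac : a ≠ c) (huw : u ≠ w) (huc : u ≠ c) (hud : u ≠ d)
    (hwb : w ≠ b) (hwd : w ≠ d) (hu : (G.neighborSet u).ncard ≤ 2)
    (hw : (G.neighborSet w).ncard ≤ 2) : G.CoreColorable S := by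
  classical
  have haS := hG.mem_of_three hua.symm hwa.symm had huw hud hwd
  have hbS := hG.mem_of_three hub.symm hbc hbd huc hud hcd.ne
  have hcS := hG.mem_of_three hwc.symm hbc.symm hcd hwb hwd hbd.ne
  have hdS := hG.mem_of_three had.symm hbd.symm hcd.symm hab hac hbc.ne
  have Na := eq_or_eq_or_eq_of_adj (hG.1 a) hua.symm hwa.symm had huw hud hwd
  have Nb := eq_or_eq_or_eq_of_adj (hG.1 b) hub.symm hbc hbd huc hud hcd.ne
  have Nc := eq_or_eq_or_eq_of_adj (hG.1 c) hwc.symm hbc.symm hcd hwb hwd hbd.ne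
  have Nd := eq_or_eq_or_eq_of_adj (hG.1 d) had.symm hbd.symm hcd.symm hab hac hbc.ne
  have Nu := eq_or_eq_of_adj hu hua hub hab
  have Nw := eq_or_eq_of_adj hw hwa hwc hac
  -- Again ten slots: the five colors occupy the pairs `cu`, `bw`, `ad`, `ad`, `bc`, each of which
  -- meets all cycles of the component.
  let f : V → Finset (Fin 5) := fun v =>
    if v = a then {2, 3} else if v = b then {1, 4} else if v = c then {0, 4} else
      if v = d then {2, 3} else if v = u then {0} else {1}
  have fa : f a = {2, 3} := by simp [f]
  have fb : f b = {1, 4} := by simp [f, hab.symm]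
  have fc : f c = {0, 4} := by simp [f, hac.symm, hbc.ne']
  have fd : f d = {2, 3} := by simp [f, had.ne', hbd.ne', hcd.ne']
  have fu : f u = {0} := by simp [f, hua.ne, hub.ne, huc, hud]
  have fw : f w = {1} := by simp [f, hwa.ne, hwc.ne, hwb, hwd, huw.symm]
  refine h.of_isolate f ?_ ?_ ?_
  · intro v
    simp only [f]
    split_ifs <;> decide
  · rintro v hv (rfl | rfl | rfl | rfl | rfl | rfl)
    · contradiction
    · contradiction
    · contradiction
    · contradiction
    · simp [fu]
    · simp [fw]
  · intro X hX i hi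
    have ma := hX.mem_of_three Na
    have mb := hX.mem_of_three Nb
    have mc := hX.mem_of_three Nc
    have md := hX.mem_of_three Nd
    have mu := hX.mem_of_two Nu
    have mw := hX.mem_of_two Nw
    simp only [Set.mem_insert_iff, Set.mem_singleton_iff, forall_eq_or_imp, forall_eq,
      fa, fb, fc, fd, fu, fw] at hi ⊢
    clear * - ma mb mc md mu mw hi
    fin_cases i <;> simp at hi <;> grind

/-- A component that is a copy of `K4` with two opposite edges `ab`, `cd` subdivided by `u`, `w`. -/
theorem CoreColorable.of_isolate_subdivided_matching (hG : G.Admissible S) {a b c d u w : V}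
    (h : (G.isolate {a, b, c, d, u, w}).CoreColorable S) (hua : G.Adj u a) (hub : G.Adj u b)
    (hwc : G.Adj w c) (hwd : G.Adj w d) (hac : G.Adj a c) (had : G.Adj a d) (hbc : G.Adj b c)
    (hbd : G.Adj b d) (hab : a ≠ b) (hcd : c ≠ d) (huw : u ≠ w) (huc : u ≠ c) (hud : u ≠ d)
    (hwa : w ≠ a) (hwb : w ≠ b) (hu : (G.neighborSet u).ncard ≤ 2)
    (hw : (G.neighborSet w).ncard ≤ 2) : G.CoreColorable S := by
  classical
  have haS := hG.mem_of_three hua.symm hac had huc hud hcd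
  have hbS := hG.mem_of_three hub.symm hbc hbd huc hud hcd
  have hcS := hG.mem_of_three hwc.symm hac.symm hbc.symm hwa hwb hab
  have hdS := hG.mem_of_three hwd.symm had.symm hbd.symm hwa hwb hab
  have Na := eq_or_eq_or_eq_of_adj (hG.1 a) hua.symm hac had huc hud hcd
  have Nb := eq_or_eq_or_eq_of_adj (hG.1 b) hub.symm hbc hbd huc hud hcd
  have Nc := eq_or_eq_or_eq_of_adj (hG.1 c) hwc.symm hac.symm hbc.symm hwa hwb hab
  have Nd := eq_or_eq_or_eq_of_adj (hG.1 d) hwd.symm had.symm hbd.symm hwa hwb hab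
  have Nu := eq_or_eq_of_adj hu hua hub hab
  have Nw := eq_or_eq_of_adj hw hwc hwd hcd
  -- The five colors occupy the pairs `cu`, `aw`, `ad`, `bc`, `bd`, each of which meets all cycles
  -- of the component.
  let f : V → Finset (Fin 5) := fun v =>
    if v = a then {1, 2} else if v = b then {3, 4} else if v = c then {0, 3} else
      if v = d then {2, 4} else if v = u then {0} else {1}
  have fa : f a = {1, 2} := by simp [f]
  have fb : f b = {3, 4} := by simp [f, hab.symm]
  have fc : f c = {0, 3} := by simp [f, hac.ne', hbc.ne']
  have fd : f d = {2, 4} := by simp [f, had.ne', hbd.ne', hcd.symm]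
  have fu : f u = {0} := by simp [f, hua.ne, hub.ne, huc, hud]
  have fw : f w = {1} := by simp [f, hwc.ne, hwd.ne, hwa, hwb, huw.symm]
  refine h.of_isolate f ?_ ?_ ?_
  · intro v
    simp only [f]
    split_ifs <;> decide
  · rintro v hv (rfl | rfl | rfl | rfl | rfl | rfl)
    · contradiction
    · contradiction
    · contradiction
    · contradiction
    · simp [fu]
    · simp [fw]
  · intro X hX i hi
    have ma := hX.mem_of_three Na
    have mb := hX.mem_of_three Nb
    have mc := hX.mem_of_three Nc
    have md := hX.mem_of_three Nd
    have mu := hX.mem_of_two Nu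
    have mw := hX.mem_of_two Nw
    simp only [Set.mem_insert_iff, Set.mem_singleton_iff, forall_eq_or_imp, forall_eq,
      fa, fb, fc, fd, fu, fw] at hi ⊢
    clear * - ma mb mc md mu mw hi
    fin_cases i <;> simp at hi <;> grind

/-- A triangle with a vertex `u` of degree two whose other vertices are in `S`. -/
theorem CoreColorable.of_isolate_triangle (hG : G.Admissible S) {u x y : V}
    (h : (G.isolate {u, x, y}).CoreColorable S) (hux : G.Adj u x) (huy : G.Adj u y)
    (hxy : G.Adj x y) (hu : (G.neighborSet u).ncard ≤ 2) (hx : x ∈ S) (hy : y ∈ S) :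
    G.CoreColorable S := by
  classical
  obtain ⟨c, hc2, hc1, hc⟩ := h.exists_card_eq
  obtain ⟨t, Nx⟩ := exists_third_of_adj (hG.1 x) hux.symm hxy huy.ne
  obtain ⟨s, Ny⟩ := exists_third_of_adj (hG.1 y) huy.symm hxy.symm hux.ne
  have Nu := eq_or_eq_of_adj hu hux huy hxy.ne
  -- A core meeting the triangle contains `x` and `y`, which carry four colors. It also contains `u`
  -- or, failing that, the outer neighbor `t` of `x`. Giving `u` a color `k` of `t` therefore
  -- supplies the fifth in both cases.
  obtain ⟨k, hk⟩ : (c t).Nonempty := by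
    rw [← Finset.card_pos]
    by_cases ht : t ∈ S
    · simp [hc2 t ht]
    · simp [hc1 t ht]
  refine ⟨fun v => if v = u then {k} else if v = x then {k + 1, k + 2} else
    if v = y then {k + 3, k + 4} else c v, ?_, ?_, ?_⟩
  · intro v
    dsimp only
    split_ifs
    · simp
    · exact Finset.card_le_two
    · exact Finset.card_le_two
    · by_cases hv : v ∈ S
      · simp [hc2 v hv]
      · simp [hc1 v hv]
  · intro v hv
    dsimp only
    split_ifs with h1 h2 h3
    · simp
    · subst h2; contradiction
    · subst h3; contradiction
    · simp [hc1 v hv]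
  · intro X hX i
    have five : i = k ∨ i = k + 1 ∨ i = k + 2 ∨ i = k + 3 ∨ i = k + 4 := by
      clear * -
      decide +revert
    by_cases hxX : x ∈ X ∧ y ∈ X
    · obtain ⟨hxX, hyX⟩ := hxX
      rcases five with hi | hi | hi | hi | hi
      · by_cases huX : u ∈ X
        · exact ⟨u, huX, by simp [hi]⟩
        · obtain ⟨p, hp, q, hq, hpq, h1, h2⟩ := hX.2 x hxX
          have key : t ∈ X ∧ G.Adj x t ∧ t ≠ u ∧ t ≠ y := by
            rcases Nx p h1 with rfl | rfl | rfl
            · contradiction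
            · rcases Nx q h2 with rfl | rfl | rfl
              · contradiction
              · contradiction
              · exact ⟨hq, h2, fun h => huX (h ▸ hq), hpq.symm⟩
            · rcases Nx q h2 with rfl | rfl | rfl
              · contradiction
              · exact ⟨hp, h1, fun h => huX (h ▸ hp), hpq⟩
              · contradiction
          exact ⟨t, key.1, by simp [key.2.2.1, key.2.2.2, key.2.1.ne', hi, hk]⟩
      · exact ⟨x, hxX, by simp [hux.ne', hi]⟩
      · exact ⟨x, hxX, by simp [hux.ne', hi]⟩
      · exact ⟨y, hyX, by simp [huy.ne', hxy.ne', hi]⟩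
      · exact ⟨y, hyX, by simp [huy.ne', hxy.ne', hi]⟩
    · have mu := hX.mem_of_two Nu
      have mx := hX.mem_of_three Nx
      have my := hX.mem_of_three Ny
      have huX : u ∉ X := by tauto
      have hxX' : x ∉ X := by tauto
      have hyX : y ∉ X := by tauto
      obtain ⟨v, hv, hi⟩ := hc X (hX.isolate (W := {u, x, y}) (by
        rintro v (rfl | rfl | rfl) <;> assumption)) i
      refine ⟨v, hv, ?_⟩
      have h1 : v ≠ u := fun h => huX (h ▸ hv)
      have h2 : v ≠ x := fun h => hxX' (h ▸ hv)
      have h3 : v ≠ y := fun h => hyX (h ▸ hv)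
      simpa [h1, h2, h3] using hi

end SimpleGraph
-- Lifting colorings through suppressed vertices.
namespace SimpleGraph

variable {V : Type*} [Finite V] {G : SimpleGraph V} {S : Set V}

theorem exists_union_card_le_one {α : Type*} [DecidableEq α] {s : Finset α} (hs : s.card ≤ 2) :
    ∃ P Q : Finset α, P ∪ Q = s ∧ P.card ≤ 1 ∧ Q.card ≤ 1 := by
  rcases s.eq_empty_or_nonempty with rfl | ⟨a, ha⟩
  · exact ⟨∅, ∅, by simp⟩
  · refine ⟨{a}, s.erase a, ?_, by simp, ?_⟩
    · rw [← Finset.insert_eq, Finset.insert_erase ha]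
    · rw [Finset.card_erase_of_mem ha]
      omega

/-- Suppressing a vertex `u` of degree two with nonadjacent neighbours `x` and `y`: the colours of
`u` can be lent to its neighbours. -/
theorem CoreColorable.of_bypass_singleton (hG : ∀ v ∉ S, (G.neighborSet v).ncard ≤ 2) {S' : Set V}
    {u x y : V} (h : (G.bypass {u} x y).CoreColorable S') (hu : (G.neighborSet u).ncard ≤ 2)
    (hux : G.Adj u x) (huy : G.Adj u y) (hxy : x ≠ y) (hadj : ¬ G.Adj x y)
    (hS : ∀ v ∈ S', v = x ∨ v = y ∨ v ∈ S) (hy : y ∈ S' → u ∈ S ∨ y ∈ S) :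
    G.CoreColorable S := by
  classical
  obtain ⟨c, hc2, hc1, hc⟩ := h
  have Nu := eq_or_eq_of_adj hu hux huy hxy
  -- `P v` is what `v` keeps and `Q v` is what it lends to `u`. Only a vertex of `S'` outside `S`
  -- lends, and at most one color.
  have split : ∀ v, ∃ P Q : Finset (Fin 5), P ∪ Q = c v ∧ P.card ≤ 2 ∧ (v ∉ S → P.card ≤ 1) ∧
      (v ∈ S → Q = ∅) ∧ Q.card ≤ 1 ∧ (v ∉ S' → Q = ∅) := by
    intro v
    by_cases hv : v ∈ S
    · exact ⟨c v, ∅, by simp, hc2 v, fun h => absurd hv h, by simp, by simp, by simp⟩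
    · by_cases hv' : v ∈ S'
      · obtain ⟨P, Q, h1, h2, h3⟩ := exists_union_card_le_one (hc2 v)
        exact ⟨P, Q, h1, by omega, fun _ => h2, fun h => absurd h hv, h3, fun h => absurd hv' h⟩
      · exact ⟨c v, ∅, by simp, hc2 v, fun _ => hc1 v hv', by simp, by simp, by simp⟩
  choose P Q hPQ hP2 hP1 hQS hQ1 hQS' using split
  refine ⟨fun v => if v = u then Q x ∪ Q y else if v = x ∨ v = y then P v else c v, ?_, ?_, ?_⟩
  · intro v
    dsimp only
    split_ifs
    · exact (Finset.card_union_le _ _).trans (Nat.add_le_add (hQ1 x) (hQ1 y))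
    · exact hP2 v
    · exact hc2 v
  · intro v hv
    dsimp only
    split_ifs with h1 h2
    · subst h1
      have : Q y = ∅ := by
        by_cases hyS : y ∈ S
        · exact hQS y hyS
        · exact hQS' y fun h => (hy h).elim hv hyS
      simp [this, hQ1 x]
    · exact hP1 v hv
    · refine hc1 v fun h => ?_
      rcases hS v h with h | h | h <;> simp_all
  · intro X hX i
    have hcore : (G.bypass {u} x y).IsCore (X \ {u}) := by
      have := hX.bypass (D := ∅) (z := u) (p := x) (q := y) (by simp) (by simpa using Nu) hxy hadj
        hux.ne' huy.ne'
      rwa [insert_empty_eq] at this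
    obtain ⟨v, ⟨hvX, hvu⟩, hi⟩ := hc _ hcore i
    have hvu : v ≠ u := hvu
    by_cases hv : v = x ∨ v = y
    · rw [← hPQ v, Finset.mem_union] at hi
      rcases hi with hi | hi
      · exact ⟨v, hvX, by simpa [hvu, hv] using hi⟩
      · refine ⟨u, ?_, ?_⟩
        -- A lender has degree at most two and is adjacent to `u`, so every core containing it
        -- contains `u`, where the lent color now sits.
        · have hvS : v ∉ S := fun h => by simp [hQS v h] at hi
          have hvu : G.Adj v u := by rcases hv with rfl | rfl <;> [exact hux.symm; exact huy.symm]
          obtain ⟨p, hp, q, hq, hpq, h1, h2⟩ := hX.2 v hvX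
          rcases eq_or_eq_of_adj (hG v hvS) h1 h2 hpq u hvu with h | h <;> rw [h] <;> assumption
        · rcases hv with rfl | rfl <;> simp [hi]
    · exact ⟨v, hvX, by simpa [hvu, hv] using hi⟩

/-- Deleting a vertex `u` with neighbours `x`, `y`, `z` and suppressing `z`. -/
theorem CoreColorable.of_bypass_pair (hG : G.Admissible S) {S' : Set V} {u x y z p q : V}
    (h : (G.bypass {z, u} p q).CoreColorable S') (hux : G.Adj u x) (huy : G.Adj u y)
    (huz : G.Adj u z) (hzp : G.Adj z p) (hzq : G.Adj z q) (hxy : x ≠ y) (hxz : x ≠ z) (hyz : y ≠ z)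
    (hpu : p ≠ u) (hqu : q ≠ u) (hpq : p ≠ q) (hadj : ¬ G.Adj p q)
    (hS : ∀ v ∈ S', v ∈ S) (hS' : ∀ v ∈ S, v ≠ x → v ≠ y → v ∈ S') (hx : x ∈ S) (hy : y ∈ S)
    (hx' : x ∉ S') (hy' : y ∉ S') : G.CoreColorable S := by
  classical
  have huS : u ∈ S := hG.mem_of_three hux huy huz hxy hxz hyz
  have hzS : z ∈ S := hG.mem_of_three huz.symm hzp hzq hpu.symm hqu.symm hpq
  have Nu := eq_or_eq_or_eq_of_adj (hG.1 u) hux huy huz hxy hxz hyz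
  have Nz := eq_or_eq_or_eq_of_adj (hG.1 z) huz.symm hzp hzq hpu.symm hqu.symm hpq
  obtain ⟨c, hc2, hc1, hc⟩ := h.exists_card_eq
  obtain ⟨a, ha⟩ := Finset.card_eq_one.1 (hc1 x hx')
  obtain ⟨b, hb⟩ := Finset.card_eq_one.1 (hc1 y hy')
  -- A core through `u` contains two of `x`, `y`, `z`. Hence two colors are put on `u` and each of
  -- the other three on two of `x`, `y`, `z`. Keeping `a` at `x` and `b` at `y` serves the cores
  -- avoiding `u`. The colors are listed as a, a + k, ..., a + 4k modulo 5, with `k` chosen so that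
  -- `b` is one of the first two.
  obtain ⟨cx, cy, cz, cu, hcx, hcy, hcz, hcu, hax, hby, hall⟩ :
      ∃ cx cy cz cu : Finset (Fin 5), cx.card ≤ 2 ∧ cy.card ≤ 2 ∧ cz.card ≤ 2 ∧ cu.card ≤ 2 ∧
        a ∈ cx ∧ b ∈ cy ∧ ∀ i, i ∈ cu ∨ (i ∈ cx ∧ i ∈ cy) ∨ (i ∈ cx ∧ i ∈ cz) ∨
          (i ∈ cy ∧ i ∈ cz) := by
    have key : ∀ k : Fin 5, k ≠ 0 → ∀ i, (i = a + 3 * k ∨ i = a + 4 * k) ∨ i = a ∨ i = a + k ∨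
        i = a + 2 * k := by
      clear * -
      decide +revert
    have hab : ∃ k : Fin 5, k ≠ 0 ∧ (b = a ∨ b = a + k) := by
      clear * -
      decide +revert
    obtain ⟨k, hk, h | h⟩ := hab
    · subst h
      refine ⟨{b, b + k}, {b, b + 2 * k}, {b + k, b + 2 * k}, {b + 3 * k, b + 4 * k},
        Finset.card_le_two, Finset.card_le_two, Finset.card_le_two, Finset.card_le_two,
        by simp, by simp, fun i => ?_⟩
      simp only [Finset.mem_insert, Finset.mem_singleton]
      have := key k hk i
      tauto
    · subst h
      refine ⟨{a, a + 2 * k}, {a + k, a + 2 * k}, {a, a + k}, {a + 3 * k, a + 4 * k},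
        Finset.card_le_two, Finset.card_le_two, Finset.card_le_two, Finset.card_le_two,
        by simp, by simp, fun i => ?_⟩
      simp only [Finset.mem_insert, Finset.mem_singleton]
      have := key k hk i
      tauto
  obtain ⟨d, hdu, hdx, hdy, hdz, hd⟩ : ∃ d : V → Finset (Fin 5), d u = cu ∧ d x = cx ∧ d y = cy ∧
      d z = cz ∧ ∀ v, v ≠ u → v ≠ x → v ≠ y → v ≠ z → d v = c v := by
    refine ⟨fun v => if v = u then cu else if v = x then cx else if v = y then cy else
      if v = z then cz else c v, ?_, ?_, ?_, ?_, ?_⟩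
    · simp
    · simp [hux.ne']
    · simp [huy.ne', hxy.symm]
    · simp [huz.ne', hxz.symm, hyz.symm]
    · intro v h1 h2 h3 h4
      simp [h1, h2, h3, h4]
  have hcard : ∀ v, (c v).card ≤ 2 := fun v => by
    by_cases hv : v ∈ S'
    · simp [hc2 v hv]
    · simp [hc1 v hv]
  refine ⟨d, ?_, ?_, ?_⟩
  · intro v
    by_cases h1 : v = u
    · rwa [h1, hdu]
    by_cases h2 : v = x
    · rwa [h2, hdx]
    by_cases h3 : v = y
    · rwa [h3, hdy]
    by_cases h4 : v = z
    · rwa [h4, hdz]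
    rw [hd v h1 h2 h3 h4]
    exact hcard v
  · intro v hv
    rw [hd v (fun h => hv (h ▸ huS)) (fun h => hv (h ▸ hx)) (fun h => hv (h ▸ hy))
      (fun h => hv (h ▸ hzS)), hc1 v fun h => hv (hS v h)]
  · intro X hX i
    by_cases huX : u ∈ X
    · have := hX.mem_of_three Nu huX
      have hi := hall i
      rw [← hdu, ← hdx, ← hdy, ← hdz] at hi
      by_contra! hcon
      have h1 := hcon u
      have h2 := hcon x
      have h3 := hcon y
      have h4 := hcon z
      clear * - this hi h1 h2 h3 h4 huX
      grind
    · have hcore : (G.bypass {z, u} p q).IsCore (X \ {z}) :=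
        hX.bypass (D := {u}) (by rintro v rfl; exact huX) Nz hpq hadj hzp.ne' hzq.ne'
      obtain ⟨v, ⟨hvX, hvz⟩, hi⟩ := hc _ hcore i
      refine ⟨v, hvX, ?_⟩
      by_cases h2 : v = x
      · subst h2
        rw [ha, Finset.mem_singleton] at hi
        rwa [hdx, hi]
      by_cases h3 : v = y
      · subst h3
        rw [hb, Finset.mem_singleton] at hi
        rwa [hdy, hi]
      rwa [hd v (fun h => huX (h ▸ hvX)) h2 h3 hvz]

end SimpleGraph
-- Minimal counterexamples: vertices of degree at most two.
namespace SimpleGraph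

variable {V : Type*} [Finite V] {G : SimpleGraph V} {S : Set V}

/-- The new neighbor of `p` or `q` only replaces one lost in `W`. -/
theorem ncard_neighborSet_bypass_le {W : Set V} {p q s t : V} (hpq : p ≠ q) (hs : s ∈ W)
    (ht : t ∈ W) (hps : G.Adj p s) (hqt : G.Adj q t) (v : V) :
    ((G.bypass W p q).neighborSet v).ncard ≤ (G.neighborSet v).ncard := by
  have key : ∀ p q s : V, p ≠ q → s ∈ W → G.Adj p s → (∀ w, (G.bypass W p q).Adj p w ↔
      (G.Adj p w ∧ p ∉ W ∧ w ∉ W) ∨ (p = p ∧ w = q ∨ p = q ∧ w = p)) →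
      ((G.bypass W p q).neighborSet p).ncard ≤ (G.neighborSet p).ncard := by
    intro p q s hpq hs hps hadj
    have : (G.bypass W p q).neighborSet p ⊆ insert q (G.neighborSet p \ {s}) := by
      intro w hw
      rcases (hadj w).1 hw with h | h | h
      · exact Or.inr ⟨h.1, fun h' => h.2.2 (by rwa [Set.mem_singleton_iff.1 h'])⟩
      · exact Or.inl h.2
      · exact absurd h.1 hpq
    refine (Set.ncard_le_ncard this).trans ((Set.ncard_insert_le _ _).trans ?_)
    exact (Set.ncard_sdiff_singleton_add_one (show s ∈ G.neighborSet p from hps)).le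
  by_cases h1 : v = p
  · subst h1
    exact key v q s hpq hs hps fun w => bypass_adj hpq
  by_cases h2 : v = q
  · subst h2
    have hsymm : G.bypass W p v = G.bypass W v p := by
      rw [bypass, bypass, edge_comm]
    rw [hsymm]
    exact key v p t hpq.symm ht hqt fun w => bypass_adj hpq.symm
  · refine Set.ncard_le_ncard fun w hw => ?_
    rcases (bypass_adj hpq).1 hw with h | h | h
    · exact h.1
    · exact absurd h.1 h1
    · exact absurd h.1 h2

/-- The neighbor `u` is lost. If `x` is an end of the new edge, the gain is offset by the loss of
`z`. This is what allows `x` to leave `S`. -/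
theorem ncard_neighborSet_bypass_pair_le_two {u x z p q : V} (hpq : p ≠ q)
    (hx : (G.neighborSet x).ncard ≤ 3) (hux : G.Adj u x) (huz : G.Adj u z)
    (hzp : G.Adj z p) (hzq : G.Adj z q) : ((G.bypass {z, u} p q).neighborSet x).ncard ≤ 2 := by
  have hxu : u ∈ G.neighborSet x := hux.symm
  by_cases hzx : G.Adj z x ∧ (x = p ∨ x = q)
  · have hxz : z ∈ G.neighborSet x \ {u} := ⟨hzx.1.symm, huz.ne'⟩
    have : ∃ r, (G.bypass {z, u} p q).neighborSet x ⊆ insert r ((G.neighborSet x \ {u}) \ {z}) := by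
      classical
      refine ⟨if x = p then q else p, fun w hw => ?_⟩
      rcases (bypass_adj hpq).1 hw with h | h | h
      · refine Or.inr ⟨⟨h.1, ?_⟩, ?_⟩ <;> simp_all
      · exact Or.inl (by simp [h])
      · exact Or.inl (by simp [h, hpq.symm])
    obtain ⟨r, hr⟩ := this
    refine (Set.ncard_le_ncard hr).trans ((Set.ncard_insert_le _ _).trans ?_)
    have h1 := Set.ncard_sdiff_singleton_add_one hxu
    have h2 := Set.ncard_sdiff_singleton_add_one hxz
    omega
  · have : (G.bypass {z, u} p q).neighborSet x ⊆ G.neighborSet x \ {u} := by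
      intro w hw
      rcases (bypass_adj hpq).1 hw with h | h | h
      · exact ⟨h.1, by simp_all⟩
      · exact absurd ⟨h.1 ▸ hzp, Or.inl h.1⟩ hzx
      · exact absurd ⟨h.1 ▸ hzq, Or.inr h.1⟩ hzx
    have h1 := Set.ncard_le_ncard this
    have h2 := Set.ncard_sdiff_singleton_add_one hxu
    omega

/-- A smallest admissible pair which cannot be coloured. -/
structure MinimalCounterexample (G : SimpleGraph V) (S : Set V) : Prop where
  admissible : G.Admissible S
  not_colorable : ¬ G.CoreColorable S
  colorable_of_ssubset : ∀ (H : SimpleGraph V) (T : Set V), H.Admissible T →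
    H.support ⊂ G.support → H.CoreColorable T

namespace MinimalCounterexample

theorem colorable_isolate (hM : G.MinimalCounterexample S) {W : Set V} {v w : V} (hv : v ∈ W)
    (hvw : G.Adj v w) : (G.isolate W).CoreColorable S :=
  hM.colorable_of_ssubset _ _ (hM.admissible.isolate W) (support_isolate_ssubset hv ⟨w, hvw⟩)

theorem not_isK4Bullet (hM : G.MinimalCounterexample S) (a b c d e : V) :
    ¬ G.IsK4Bullet a b c d e := fun h =>
  hM.not_colorable (.of_isolate_k4Bullet hM.admissible h (hM.colorable_isolate (by simp) h.ac))

theorem exists_ne_adj (hM : G.MinimalCounterexample S) {v a : V} (h : G.Adj v a) :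
    ∃ b, b ≠ a ∧ G.Adj v b := by
  by_contra! hcon
  refine hM.not_colorable (.of_isolate_singleton (hM.colorable_isolate rfl h) ?_)
  refine (Set.ncard_le_one_iff).2 fun {b c} hb hc => ?_
  have hb' : b = a := by_contra fun h => hcon b h hb
  have hc' : c = a := by_contra fun h => hcon c h hc
  rw [hb', hc']

/-- At most one vertex of a triangle is outside `S`. If there is one, it has degree at most two and
takes the role of `u` in `CoreColorable.of_isolate_triangle`. -/
theorem not_ncard_le_two_of_triangle (hM : G.MinimalCounterexample S) {u x y : V}
    (hux : G.Adj u x) (huy : G.Adj u y) (hxy : G.Adj x y) : ¬ (G.neighborSet u).ncard ≤ 2 := by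
  have hG := hM.admissible
  intro hu
  by_cases hx : x ∈ S
  · by_cases hy : y ∈ S
    · exact hM.not_colorable
        (.of_isolate_triangle hG (hM.colorable_isolate (by simp) hux) hux huy hxy hu hx hy)
    · exact hM.not_colorable
        (.of_isolate_triangle hG (hM.colorable_isolate (by simp) huy.symm) huy.symm hxy.symm hux
          (hG.deg_le_two y hy) (by_contra fun h => hG.triangle u y x huy hux hxy.symm h hy) hx)
  · exact hM.not_colorable
      (.of_isolate_triangle hG (hM.colorable_isolate (by simp) hux.symm) hux.symm hxy huy
        (hG.deg_le_two x hx) (by_contra fun h => hG.triangle u x y hux huy hxy h hx)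
        (by_contra fun h => hG.triangle x y u hxy hux.symm huy.symm hx h))

end MinimalCounterexample

/-- Undoing the suppression subdivides the edge `xy` of a new obstruction. A triangle becomes a
4-cycle outside `S`, and `K4` becomes a `K4Bullet`. A `K4Bullet` becomes `K4` with two subdivided
edges, adjacent (`hpath`) or opposite (`hmatching`), the case of one edge subdivided twice being
impossible. -/
theorem Admissible.bypass_singleton (hG : G.Admissible S) {S' : Set V} {u x y : V}
    (hux : G.Adj u x) (huy : G.Adj u y) (hxy : x ≠ y) (hS : ∀ v ∉ S', v ∉ S) (hx : x ∈ S') (hy : y ∉ S' → u ∉ S ∧ x ∉ S)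
    (hK : ∀ a b c d e, ¬ G.IsK4Bullet a b c d e)
    (hpath : ∀ a b c d w, G.Adj w a → G.Adj w b → G.Adj u a → G.Adj u c → G.Adj a d →
      G.Adj b c → G.Adj b d → G.Adj c d → a ≠ b → a ≠ c → w ≠ u → w ≠ c → w ≠ d → u ≠ b → u ≠ d →
      w ∉ S → False)
    (hmatching : ∀ a b c d w, G.Adj w a → G.Adj w b → G.Adj u c → G.Adj u d → G.Adj a c →
      G.Adj a d → G.Adj b c → G.Adj b d → a ≠ b → c ≠ d → w ≠ u → w ≠ c → w ≠ d → u ≠ a → u ≠ b →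
      w ∉ S → False) :
    (G.bypass {u} x y).Admissible S' := by
  have hdeg := ncard_neighborSet_bypass_le (W := {u}) hxy rfl rfl hux.symm huy.symm
  have hadj : ∀ s t, (G.bypass {u} x y).Adj s t →
      (G.Adj s t ∧ s ≠ u ∧ t ≠ u) ∨ (s = x ∧ t = y ∨ s = y ∧ t = x) :=
    fun s t h => (bypass_adj hxy).1 h
  refine ⟨fun v => (hdeg v).trans (hG.1 v), fun v hv => (hdeg v).trans (hG.2 v (hS v hv)),
    ?_, ?_, ?_, ?_⟩
  · have key : ∀ a t, a ∉ S' → t = x → G.Adj a t → a ≠ u → y ∉ S' → G.Adj a y → False := by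
      rintro a t ha rfl hat hau hyS hay
      have := hy hyS
      exact hG.square u t a y hux hat.symm hay huy.symm hau.symm hxy this.1 this.2 (hS a ha)
        (hS y hyS)
    intro a b t h1 h2 h3 ha hb
    have hax : a ≠ x := fun h => ha (h ▸ hx)
    have hbx : b ≠ x := fun h => hb (h ▸ hx)
    have h1' : G.Adj a b ∧ a ≠ u ∧ b ≠ u := by
      rcases hadj _ _ h1 with h | h | h
      · exact h
      · exact absurd h.1 hax
      · exact absurd h.2 hbx
    rcases hadj _ _ h2 with h2' | h | ⟨rfl, h⟩
    · rcases hadj _ _ h3 with h3' | h | ⟨rfl, h⟩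
      · exact hG.triangle a b t h1'.1 h2'.1 h3'.1 (hS a ha) (hS b hb)
      · exact hbx h.1
      · exact key a t ha h h2'.1 h1'.2.1 hb h1'.1
    · exact hax h.1
    · rcases hadj _ _ h3 with h3' | h' | h'
      · exact key b t hb h h3'.1 h1'.2.2 ha h1'.1.symm
      · exact hbx h'.1
      · exact h1'.1.ne h'.1.symm
  · intro a b c d h1 h2 h3 h4 hac hbd ha hb hc hd
    have hax : a ≠ x := fun h => ha (h ▸ hx)
    have hbx : b ≠ x := fun h => hb (h ▸ hx)
    have hcx : c ≠ x := fun h => hc (h ▸ hx)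
    have hdx : d ≠ x := fun h => hd (h ▸ hx)
    refine hG.square a b c d ?_ ?_ ?_ ?_ hac hbd (hS a ha) (hS b hb) (hS c hc) (hS d hd)
    · have := hadj _ _ h1; tauto
    · have := hadj _ _ h2; tauto
    · have := hadj _ _ h3; tauto
    · have := hadj _ _ h4; tauto
  · have key : ∀ a b c d, (G.bypass {u} x y).Adj a b → (G.bypass {u} x y).Adj a c →
        (G.bypass {u} x y).Adj a d → (G.bypass {u} x y).Adj b c → (G.bypass {u} x y).Adj b d →
        (G.bypass {u} x y).Adj c d → a = x → b = y → False := by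
      rintro a b c d h1 h2 h3 h4 h5 h6 rfl rfl
      have e1 := h1.ne
      have e2 := h2.ne
      have e3 := h3.ne
      have e4 := h4.ne
      have e5 := h5.ne
      have g2 := hadj _ _ h2
      have g3 := hadj _ _ h3
      have g4 := hadj _ _ h4
      have g5 := hadj _ _ h5
      have g6 := hadj _ _ h6
      refine hK a b c d u ⟨e1, ?_, ?_, ?_, ?_, ?_, ?_, ?_, hux, huy⟩ <;>
        clear * - g2 g3 g4 g5 g6 e1 e2 e3 e4 e5 <;> grind
    intro a b c d h1 h2 h3 h4 h5 h6
    rcases hadj _ _ h1 with g1 | ⟨e, f⟩ | ⟨e, f⟩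
    rotate_left
    · exact key a b c d h1 h2 h3 h4 h5 h6 e f
    · exact key b a c d h1.symm h4 h5 h2 h3 h6 f e
    rcases hadj _ _ h2 with g2 | ⟨e, f⟩ | ⟨e, f⟩
    rotate_left
    · exact key a c b d h2 h1 h3 h4.symm h6 h5 e f
    · exact key c a b d h2.symm h4.symm h6 h1 h3 h5 f e
    rcases hadj _ _ h3 with g3 | ⟨e, f⟩ | ⟨e, f⟩
    rotate_left
    · exact key a d b c h3 h1 h2 h5.symm h6.symm h4 e f
    · exact key d a b c h3.symm h5.symm h6.symm h1 h2 h4 f e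
    rcases hadj _ _ h4 with g4 | ⟨e, f⟩ | ⟨e, f⟩
    rotate_left
    · exact key b c a d h4 h1.symm h5 h2.symm h6 h3 e f
    · exact key c b a d h4.symm h2.symm h6 h1.symm h5 h3 f e
    rcases hadj _ _ h5 with g5 | ⟨e, f⟩ | ⟨e, f⟩
    rotate_left
    · exact key b d a c h5 h1.symm h4 h3.symm h6.symm h2 e f
    · exact key d b a c h5.symm h3.symm h6.symm h1.symm h4 h2 f e
    rcases hadj _ _ h6 with g6 | ⟨e, f⟩ | ⟨e, f⟩
    rotate_left
    · exact key c d a b h6 h2.symm h4.symm h3.symm h5.symm h1 e f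
    · exact key d c a b h6.symm h3.symm h5.symm h2.symm h4.symm h1 f e
    exact hG.k4 a b c d g1.1 g2.1 g3.1 g4.1 g5.1 g6.1
  · have end_edge : ∀ a b c d e, (G.bypass {u} x y).IsK4Bullet a b c d e → e ∉ S' →
        G.Adj e a ∧ e ≠ u ∧ a ≠ u := by
      intro a b c d e h he
      rcases hadj _ _ h.ea with g | ⟨h1, -⟩ | ⟨h1, h2⟩
      · exact g
      · exact absurd (h1 ▸ hx) he
      -- Here one edge would be subdivided twice: `e` is `y` and `a` is `x`. Then `x` has the
      -- neighbors `c`, `d`, `u` in `G`, which forces it into `S`.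
      · refine absurd ?_ (hy (h1 ▸ he)).2
        have g1 := hadj _ _ h.ac
        have g2 := hadj _ _ h.ad
        have e1 := h.ne_ec
        have e2 := h.ne_ed
        refine hG.mem_of_three (p := c) (q := d) (r := u) ?_ ?_ hux.symm h.cd.ne ?_ ?_ <;>
          clear * - g1 g2 e1 e2 h1 h2 hxy <;> grind
    have side_edge : ∀ a b c d e, (G.bypass {u} x y).IsK4Bullet a b c d e → e ∉ S' →
        G.Adj a c ∧ a ≠ u ∧ c ≠ u := by
      intro a b c d e h he
      rcases hadj _ _ h.ac with g | hn
      · exact g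
      · exfalso
        have k1 := end_edge a b c d e h he
        have k2 := end_edge b a c d e ⟨h.ne_ab.symm, h.ne_ec, h.ne_ed, h.bc, h.bd, h.ac, h.ad, h.cd,
          h.eb, h.ea⟩ he
        have g1 := hadj _ _ h.ad
        have g2 := hadj _ _ h.bc
        have g3 := hadj _ _ h.bd
        have g4 := hadj _ _ h.cd
        have e1 := h.ne_ab
        have e2 := h.ac.ne
        have e3 := h.ad.ne
        have e4 := h.bc.ne
        have e5 := h.bd.ne
        have e6 := h.cd.ne
        have hua : G.Adj u a := by rcases hn with hn | hn <;> rw [hn.1] <;> assumption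
        have huc : G.Adj u c := by rcases hn with hn | hn <;> rw [hn.2] <;> assumption
        refine hpath a b c d e k1.1 k2.1 hua huc ?_ ?_ ?_ ?_ e1 e2 k1.2.1 h.ne_ec h.ne_ed
          k2.2.2.symm ?_ (hS e he) <;>
          clear * - g1 g2 g3 g4 e1 e2 e3 e4 e5 e6 hn <;> grind
    rintro a b c d e h
    by_contra he
    have h' : (G.bypass {u} x y).IsK4Bullet b a c d e :=
      ⟨h.ne_ab.symm, h.ne_ec, h.ne_ed, h.bc, h.bd, h.ac, h.ad, h.cd, h.eb, h.ea⟩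
    have hea := end_edge a b c d e h he
    have heb := end_edge b a c d e h' he
    have hac := side_edge a b c d e h he
    have hbc := side_edge b a c d e h' he
    have had := side_edge a b d c e
      ⟨h.ne_ab, h.ne_ed, h.ne_ec, h.ad, h.ac, h.bd, h.bc, h.cd.symm, h.ea, h.eb⟩ he
    have hbd := side_edge b a d c e
      ⟨h'.ne_ab, h'.ne_ed, h'.ne_ec, h'.ad, h'.ac, h'.bd, h'.bc, h'.cd.symm, h'.ea, h'.eb⟩ he
    rcases hadj _ _ h.cd with hcd | hn
    · exact hK a b c d e ⟨h.ne_ab, h.ne_ec, h.ne_ed, hac.1, had.1, hbc.1, hbd.1, hcd.1, hea.1, heb.1⟩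
    · have huc : G.Adj u c := by rcases hn with hn | hn <;> rw [hn.1] <;> assumption
      have hud : G.Adj u d := by rcases hn with hn | hn <;> rw [hn.2] <;> assumption
      exact hmatching a b c d e hea.1 heb.1 huc hud hac.1 had.1 hbc.1 hbd.1 h.ne_ab h.cd.ne hea.2.1
        h.ne_ec h.ne_ed hea.2.2.symm heb.2.2.symm (hS e he)

namespace MinimalCounterexample

theorem not_ncard_le_two (hM : G.MinimalCounterexample S) {u v : V} (huv : G.Adj u v) :
    ¬ (G.neighborSet u).ncard ≤ 2 := by
  classical
  have hG := hM.admissible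
  intro hu
  have main : ∀ x y, G.Adj u x → G.Adj u y → x ≠ y → (x ∈ S → y ∈ S) → False := by
    intro x y hux huy hxy hpref
    have hadj : ¬ G.Adj x y := fun h => hM.not_ncard_le_two_of_triangle hux huy h hu
    -- `x` may always borrow a slot of `u`; `y` may do so as well only if `u` has two.
    obtain ⟨T, hT⟩ : ∃ T : Set V, ∀ v, v ∈ T ↔ v ∈ S ∨ v = x ∨ (v = y ∧ u ∈ S) :=
      ⟨{v | v ∈ S ∨ v = x ∨ (v = y ∧ u ∈ S)}, fun _ => Iff.rfl⟩
    have hadm : (G.bypass {u} x y).Admissible T := by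
      refine hG.bypass_singleton hux huy hxy (fun v hv h => hv ((hT v).2 (Or.inl h)))
        ((hT x).2 (by simp)) ?_ hM.not_isK4Bullet ?_ ?_
      · intro h
        rw [hT] at h
        tauto
      · intro a b c d w h1 h2 h3 h4 h5 h6 h7 h8 n1 n2 n3 n4 n5 n6 n7 hw
        exact hM.not_colorable (.of_isolate_subdivided_path hG (hM.colorable_isolate (by simp) h1.symm)
          h1 h2 h3 h4 h5 h6 h7 h8 n1 n2 n3 n4 n5 n6 n7 (hG.deg_le_two w hw) hu)
      · intro a b c d w h1 h2 h3 h4 h5 h6 h7 h8 n1 n2 n3 n4 n5 n6 n7 hw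
        exact hM.not_colorable (.of_isolate_subdivided_matching hG
          (hM.colorable_isolate (by simp) h1.symm)
          h1 h2 h3 h4 h5 h6 h7 h8 n1 n2 n3 n4 n5 n6 n7 (hG.deg_le_two w hw) hu)
    refine hM.not_colorable (.of_bypass_singleton (S' := T) hG.deg_le_two
      (hM.colorable_of_ssubset _ _ hadm (support_bypass_ssubset hxy ⟨u, hux.symm⟩ ⟨u, huy.symm⟩
        hux.ne' huy.ne' rfl ⟨x, hux⟩)) hu hux huy hxy hadj ?_ ?_)
    · intro v hv
      have := (hT v).1 hv
      tauto
    · intro h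
      have := (hT y).1 h
      have := hxy.symm
      tauto
  obtain ⟨w, hwv, huw⟩ := hM.exists_ne_adj huv
  -- The role of `x` goes to a neighbor outside `S` when there is one, since it gains the slot for
  -- certain.
  by_cases h : v ∈ S → w ∈ S
  · exact main v w huv huw hwv.symm h
  · exact main w v huw huv hwv (by tauto)

end MinimalCounterexample

end SimpleGraph
-- Minimal counterexamples: the cubic case.
namespace SimpleGraph

variable {V : Type*} [Finite V] {G : SimpleGraph V} {S : Set V}

/-- The vertices `a, b, c, d` span at least a copy of `K4` without the edge `ab`. -/
structure IsDiamond (G : SimpleGraph V) (a b c d : V) : Prop where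
  ne_ab : a ≠ b
  ac : G.Adj a c
  ad : G.Adj a d
  bc : G.Adj b c
  bd : G.Adj b d
  cd : G.Adj c d

namespace MinimalCounterexample

theorem mem_of_adj (hM : G.MinimalCounterexample S) {v w : V} (h : G.Adj v w) : v ∈ S :=
  by_contra fun hv => hM.not_ncard_le_two h (hM.admissible.deg_le_two v hv)

theorem exists_third (hM : G.MinimalCounterexample S) {v a b : V} (ha : G.Adj v a)
    (hab : a ≠ b) : ∃ c, G.Adj v c ∧ c ≠ a ∧ c ≠ b := by
  by_contra! hcon
  refine hM.not_ncard_le_two ha ((Set.ncard_le_ncard (t := {a, b}) fun c hc => ?_).trans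
    (Set.ncard_pair hab).le)
  by_contra hc'
  simp only [Set.mem_insert_iff, Set.mem_singleton_iff, not_or] at hc'
  exact hc'.2 (hcon c hc hc'.1)

/-- Deleting `u` and suppressing its neighbour `z` must create a new obstruction. -/
theorem false_of_bypass_pair (hM : G.MinimalCounterexample S) {u x y z p q : V} (hux : G.Adj u x)
    (huy : G.Adj u y) (huz : G.Adj u z) (hzp : G.Adj z p) (hzq : G.Adj z q) (hxy : x ≠ y)
    (hxz : x ≠ z) (hyz : y ≠ z) (hpu : p ≠ u) (hqu : q ≠ u) (hpq : p ≠ q) (hadj : ¬ G.Adj p q)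
    (htri : ∀ t, (G.bypass {z, u} p q).Adj x y → (G.bypass {z, u} p q).Adj x t →
      (G.bypass {z, u} p q).Adj y t → False)
    (hdia : (x = p ∧ y = q) ∨ ∀ a b c d, (G.bypass {z, u} p q).IsDiamond a b c d →
      (∀ v ∈ ({a, b, c, d} : Set V), v ≠ x ∧ v ≠ y) → False) : False := by
  have hG := hM.admissible
  have hadj' : ∀ s t, (G.bypass {z, u} p q).Adj s t →
      (G.Adj s t ∧ s ∉ ({z, u} : Set V) ∧ t ∉ ({z, u} : Set V)) ∨ (s = p ∧ t = q ∨ s = q ∧ t = p) :=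
    fun s t h => (bypass_adj hpq).1 h
  have hS : ∀ s t, (G.bypass {z, u} p q).Adj s t → s ∈ S := by
    intro s t h
    rcases hadj' s t h with h | ⟨rfl, -⟩ | ⟨rfl, -⟩
    · exact hM.mem_of_adj h.1
    · exact hM.mem_of_adj hzp.symm
    · exact hM.mem_of_adj hzq.symm
  have hx2 := ncard_neighborSet_bypass_pair_le_two hpq (hG.1 x) hux huz hzp hzq
  have hy2 := ncard_neighborSet_bypass_pair_le_two hpq (hG.1 y) huy huz hzp hzq
  have hxyS : ∀ s t, (G.bypass {z, u} p q).Adj s t → s ∉ S \ {x, y} → s = x ∨ s = y := by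
    intro s t h hs
    by_contra hs'
    exact hs ⟨hS s t h, hs'⟩
  have hne : ∀ s a b c, (G.bypass {z, u} p q).Adj s a → (G.bypass {z, u} p q).Adj s b →
      (G.bypass {z, u} p q).Adj s c → a ≠ b → a ≠ c → b ≠ c → s ≠ x ∧ s ≠ y := by
    intro s a b c ha hb hc hab hac hbc
    exact ⟨fun h => SimpleGraph.not_ncard_le_two ha hb hc hab hac hbc (h ▸ hx2),
      fun h => SimpleGraph.not_ncard_le_two ha hb hc hab hac hbc (h ▸ hy2)⟩
  -- If the new edge is `xy` itself, every edge at another vertex is already in `G`. The branch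
  -- vertices of a new `K4` or `K4Bullet` have degree three and so are neither `x` nor `y`, which
  -- puts the whole obstruction in `G`.
  replace hdia := hdia.imp_left fun hpq' s t (h : (G.bypass {z, u} p q).Adj s t)
      (hs : s ≠ x ∧ s ≠ y) => show G.Adj s t by
    rcases hadj' s t h with h | h | h
    · exact h.1
    · exact absurd (h.1.trans hpq'.1.symm) hs.1
    · exact absurd (h.1.trans hpq'.2.symm) hs.2
  have hadm : (G.bypass {z, u} p q).Admissible (S \ {x, y}) := by
    refine ⟨fun v => (ncard_neighborSet_bypass_le hpq (s := z) (t := z) (by simp) (by simp)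
      hzp.symm hzq.symm v).trans (hG.1 v), ?_, ?_, ?_, ?_, ?_⟩
    · intro v hv
      by_contra hcon
      obtain ⟨w, hw⟩ : ((G.bypass {z, u} p q).neighborSet v).Nonempty := by
        rw [← Set.ncard_pos]
        omega
      rcases hxyS v w hw hv with rfl | rfl
      · exact hcon hx2
      · exact hcon hy2
    · intro a b t h1 h2 h3 ha hb
      rcases hxyS a b h1 ha with rfl | rfl <;> rcases hxyS b a h1.symm hb with rfl | rfl
      · exact h1.ne rfl
      · exact htri t h1 h2 h3
      · exact htri t h1.symm h3 h2
      · exact h1.ne rfl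
    · intro a b c d h1 h2 h3 h4 hac hbd ha hb hc hd
      have e1 := h1.ne
      have e2 := h2.ne
      rcases hxyS a b h1 ha with rfl | rfl <;> rcases hxyS b c h2 hb with rfl | rfl <;>
        rcases hxyS c d h3 hc with rfl | rfl <;> contradiction
    · intro a b c d h1 h2 h3 h4 h5 h6
      have ha := hne a b c d h1 h2 h3 h4.ne h5.ne h6.ne
      have hb := hne b a c d h1.symm h4 h5 h2.ne h3.ne h6.ne
      have hc := hne c a b d h2.symm h4.symm h6 h1.ne h3.ne h5.ne
      have hd := hne d a b c h3.symm h5.symm h6.symm h1.ne h2.ne h4.ne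
      rcases hdia with hold | hdia
      · exact hG.k4 a b c d (hold _ _ h1 ha) (hold _ _ h2 ha) (hold _ _ h3 ha) (hold _ _ h4 hb)
          (hold _ _ h5 hb) (hold _ _ h6 hc)
      · refine hdia a b c d ⟨h1.ne, h2, h3, h4, h5, h6⟩ ?_
        rintro v (rfl | rfl | rfl | rfl) <;> assumption
    · intro a b c d e h
      by_contra he
      have ha := hne a c d e h.ac h.ad h.ea.symm h.cd.ne h.ne_ec.symm h.ne_ed.symm
      have hb := hne b c d e h.bc h.bd h.eb.symm h.cd.ne h.ne_ec.symm h.ne_ed.symm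
      have hc := hne c a b d h.ac.symm h.bc.symm h.cd h.ne_ab h.ad.ne h.bd.ne
      have hd := hne d a b c h.ad.symm h.bd.symm h.cd.symm h.ne_ab h.ac.ne h.bc.ne
      rcases hdia with hold | hdia
      · exact hM.not_isK4Bullet a b c d e ⟨h.ne_ab, h.ne_ec, h.ne_ed, hold _ _ h.ac ha,
          hold _ _ h.ad ha, hold _ _ h.bc hb, hold _ _ h.bd hb, hold _ _ h.cd hc,
          (hold _ _ h.ea.symm ha).symm, (hold _ _ h.eb.symm hb).symm⟩
      · refine hdia a b c d ⟨h.ne_ab, h.ac, h.ad, h.bc, h.bd, h.cd⟩ ?_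
        rintro v (rfl | rfl | rfl | rfl) <;> assumption
  refine hM.not_colorable (.of_bypass_pair hG (hM.colorable_of_ssubset _ _ hadm
    (support_bypass_ssubset (v := u) hpq ⟨z, hzp.symm⟩ ⟨z, hzq.symm⟩ ?_ ?_ (by simp) ⟨x, hux⟩))
    hux huy huz hzp hzq hxy hxz hyz hpu hqu hpq hadj (fun v h => h.1) ?_ (hM.mem_of_adj hux.symm)
    (hM.mem_of_adj huy.symm) (by simp) (by simp))
  · simp [hzp.ne', hpu]
  · simp [hzq.ne', hqu]
  · intro v hv h1 h2
    exact ⟨hv, by simp [h1, h2]⟩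

/-- Deleting `c` and suppressing `d` joins the tips `a` and `b`. A triangle on this new edge would
come from a `K4Bullet` in `G`. -/
theorem not_isDiamond (hM : G.MinimalCounterexample S) (a b c d : V) : ¬ G.IsDiamond a b c d := by
  intro h
  have hab : ¬ G.Adj a b := fun hab =>
    hM.admissible.k4 a b c d hab h.ac h.ad h.bc h.bd h.cd
  refine hM.false_of_bypass_pair (u := c) (x := a) (y := b) (z := d) (p := a) (q := b) h.ac.symm
    h.bc.symm h.cd h.ad.symm h.bd.symm h.ne_ab h.ad.ne h.bd.ne h.ac.ne h.bc.ne h.ne_ab hab ?_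
    (Or.inl ⟨rfl, rfl⟩)
  intro t _ hat hbt
  have h1 := hat.ne
  have h2 := hbt.ne
  rw [bypass_adj h.ne_ab] at hat hbt
  have hat' : G.Adj a t ∧ a ∉ ({d, c} : Set V) ∧ t ∉ ({d, c} : Set V) := by
    have := h.ne_ab
    clear * - hat hbt h1 h2 this
    grind
  have hbt' : G.Adj b t := by
    have := h.ne_ab
    clear * - hat hbt h1 h2 this
    grind
  have ht := hat'.2.2
  simp only [Set.mem_insert_iff, Set.mem_singleton_iff, not_or] at ht
  exact hM.not_isK4Bullet a b c d t
    ⟨h.ne_ab, ht.2, ht.1, h.ac, h.ad, h.bc, h.bd, h.cd, hat'.1.symm, hbt'.symm⟩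

/-- Deleting `a` and suppressing `b` puts the new edge at `c`, one of the two restricted neighbors
of `a`. A diamond avoiding `c` is then already in `G`, and a triangle through `c` and `a'` would
require an edge `ca'`, hence a diamond in `G`. -/
theorem not_triangle (hM : G.MinimalCounterexample S) {a b c : V} (hab : G.Adj a b)
    (hac : G.Adj a c) (hbc : G.Adj b c) : False := by
  obtain ⟨a', haa', h1, h2⟩ := hM.exists_third hab hbc.ne
  obtain ⟨b', hbb', h3, h4⟩ := hM.exists_third hab.symm hac.ne
  have hcb' : ¬ G.Adj c b' := fun h =>
    hM.not_isDiamond a b' b c ⟨h3.symm, hab, hac, hbb'.symm, h.symm, hbc⟩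
  refine hM.false_of_bypass_pair hac haa' hab hbc hbb' h2.symm hbc.ne' h1 hac.ne' h3 h4.symm hcb'
    ?_ (Or.inr ?_)
  · intro t h _ _
    rw [bypass_adj h4.symm] at h
    rcases h with h | h | h
    · exact hM.not_isDiamond b a' a c ⟨h1.symm, hab.symm, hbc, haa'.symm, h.1.symm, hac⟩
    · exact hM.not_isDiamond c a' a b
        ⟨h2.symm, hac.symm, hbc.symm, haa'.symm, h.2 ▸ hbb'.symm, hab⟩
    · exact h4 h.1.symm
  · intro p q r s h hc
    have hadj : ∀ v w, v ≠ c → w ≠ c → (G.bypass {b, a} c b').Adj v w → G.Adj v w := by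
      intro v w hv hw h
      rcases (bypass_adj h4.symm).1 h with h | h | h
      · exact h.1
      · exact absurd h.1 hv
      · exact absurd h.2 hw
    have hp := (hc p (by simp)).1
    have hq := (hc q (by simp)).1
    have hr := (hc r (by simp)).1
    have hs := (hc s (by simp)).1
    exact hM.not_isDiamond p q r s ⟨h.ne_ab, hadj _ _ hp hr h.ac, hadj _ _ hp hs h.ad,
      hadj _ _ hq hr h.bc, hadj _ _ hq hs h.bd, hadj _ _ hr hs h.cd⟩

/-- In a triangle-free graph, a diamond created by suppressing `z` yields common neighbours of
`p` and `q` other than `z`. -/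
theorem isDiamond_bypass (hM : G.MinimalCounterexample S) {u z p q a b c d : V} (hpq : p ≠ q)
    (h : (G.bypass {z, u} p q).IsDiamond a b c d) : a ≠ z ∧ b ≠ z ∧ G.Adj p a ∧ G.Adj q a ∧
      G.Adj p b ∧ G.Adj q b := by
  have g1 := (bypass_adj hpq).1 h.ac
  have g2 := (bypass_adj hpq).1 h.ad
  have g3 := (bypass_adj hpq).1 h.bc
  have g4 := (bypass_adj hpq).1 h.bd
  have g5 := (bypass_adj hpq).1 h.cd
  have e1 := h.ne_ab
  have e2 := h.ac.ne
  have e3 := h.ad.ne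
  have e4 := h.bc.ne
  have e5 := h.bd.ne
  have e6 := h.cd.ne
  have t1 : ¬ (G.Adj a c ∧ G.Adj a d ∧ G.Adj c d) := fun h => hM.not_triangle h.1 h.2.1 h.2.2
  have t2 : ¬ (G.Adj b c ∧ G.Adj b d ∧ G.Adj c d) := fun h => hM.not_triangle h.1 h.2.1 h.2.2
  simp only [Set.mem_insert_iff, Set.mem_singleton_iff] at g1 g2 g3 g4 g5
  -- If the new edge were not `cd`, one of the triangles `acd`, `bcd` would lie in `G`.
  have hcd : c = p ∧ d = q ∨ c = q ∧ d = p := by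
    clear h
    grind
  rcases hcd with ⟨rfl, rfl⟩ | ⟨rfl, rfl⟩
  · have k1 : G.Adj a c ∧ a ≠ z := by clear h; grind
    have k2 : G.Adj a d := by clear h; grind
    have k3 : G.Adj b c ∧ b ≠ z := by clear h; grind
    have k4 : G.Adj b d := by clear h; grind
    exact ⟨k1.2, k3.2, k1.1.symm, k2.symm, k3.1.symm, k4.symm⟩
  · have k1 : G.Adj a c ∧ a ≠ z := by clear h; grind
    have k2 : G.Adj a d := by clear h; grind
    have k3 : G.Adj b c ∧ b ≠ z := by clear h; grind
    have k4 : G.Adj b d := by clear h; grind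
    exact ⟨k1.2, k3.2, k2.symm, k1.1.symm, k4.symm, k3.1.symm⟩

/-- Delete `p` and suppress `r`. By `isDiamond_bypass` a new diamond has a tip adjacent to `q` other
than `r`, and this is `s` or `t`, the vertices it must avoid. -/
theorem not_completeBipartite_two_three (hM : G.MinimalCounterexample S) {p q r s t : V}
    (hpq : p ≠ q) (hrs : r ≠ s) (hrt : r ≠ t) (hst : s ≠ t) (hpr : G.Adj p r) (hps : G.Adj p s)
    (hpt : G.Adj p t) (hqr : G.Adj q r) (hqs : G.Adj q s) (hqt : G.Adj q t) : False := by
  obtain ⟨r', hr, h1, h2⟩ := hM.exists_third hpr.symm hpq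
  have Nq := eq_or_eq_or_eq_of_adj (hM.admissible.1 q) hqr hqs hqt hrs hrt hst
  refine hM.false_of_bypass_pair hps hpt hpr hqr.symm hr hst hrs.symm hrt.symm hpq.symm h1 h2.symm
    (fun h => hM.not_triangle hqr.symm hr h) ?_ (Or.inr ?_)
  · intro v h _ _
    rcases (bypass_adj h2.symm).1 h with h | h | h
    · exact hM.not_triangle hps hpt h.1
    · exact hqs.ne h.1.symm
    · exact hqt.ne h.2.symm
  · intro a b c d h hav
    have := hM.isDiamond_bypass h2.symm h
    have ha := hav a (by simp)
    rcases Nq a this.2.2.1 with h | h | h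
    · exact this.1 h
    · exact ha.1 h
    · exact ha.2 h

end MinimalCounterexample

/-- With no triangle, only a diamond can obstruct the reduction. Its two tips together with `z` are
three common neighbors of `p` and `q`, forming a K_{2,3}. -/
theorem not_minimalCounterexample (hM : G.MinimalCounterexample S) : False := by
  by_cases hE : ∃ u x, G.Adj u x
  · obtain ⟨u, x, hux⟩ := hE
    obtain ⟨y, hyx, huy⟩ := hM.exists_ne_adj hux
    obtain ⟨z, huz, hzx, hzy⟩ := hM.exists_third hux hyx.symm
    obtain ⟨p, hpu, hzp⟩ := hM.exists_ne_adj huz.symm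
    obtain ⟨q, hzq, hqu, hqp⟩ := hM.exists_third huz.symm hpu.symm
    refine hM.false_of_bypass_pair hux huy huz hzp hzq hyx.symm hzx.symm hzy.symm hpu hqu hqp.symm
      (fun h => hM.not_triangle hzp hzq h) ?_ (Or.inr ?_)
    · intro t h _ _
      rcases (bypass_adj hqp.symm).1 h with h | h | h
      · exact hM.not_triangle hux huy h.1
      · exact hM.not_triangle hux huz (h.1 ▸ hzp.symm)
      · exact hM.not_triangle hux huz (h.1 ▸ hzq.symm)
    · intro a b c d h _
      obtain ⟨h1, h2, h3, h4, h5, h6⟩ := hM.isDiamond_bypass hqp.symm h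
      exact hM.not_completeBipartite_two_three hqp.symm h1.symm h2.symm h.ne_ab hzp.symm h3 h5
        hzq.symm h4 h6
  · refine hM.not_colorable ⟨fun _ => ∅, by simp, by simp, fun X hX => ?_⟩
    obtain ⟨x, hx⟩ := hX.1
    obtain ⟨a, -, -, -, -, h, -⟩ := hX.2 x hx
    exact absurd ⟨x, a, h⟩ hE

/-- The main colouring theorem for subcubic graphs without obstructions. -/
theorem Admissible.coreColorable (hG : G.Admissible S) : G.CoreColorable S := by
  -- Both reductions keep the vertex type, so the support measures the size.
  induction hn : G.support.ncard using Nat.strong_induction_on generalizing G S with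
  | _ n ih =>
    subst hn
    by_contra hcon
    exact not_minimalCounterexample ⟨hG, hcon, fun H T hH hlt =>
      ih _ (Set.ncard_lt_ncard hlt) hH rfl⟩

end SimpleGraph

/-! ### Forests are balanced. -/

namespace Signature

variable {V : Type*} {G : SimpleGraph V}

/-- Switching once at each vertex where `s` is -1 turns one signature into the other. -/
theorem switchingEquivalent_of_eq_mul [Finite V] (σ τ : Signature G) (s : V → ℤˣ)
    (h : ∀ a b (hab : G.Adj a b), σ ⟨s(a, b), hab⟩ = s a * s b * τ ⟨s(a, b), hab⟩) :
    σ.SwitchingEquivalent τ := by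
  classical
  induction hn : {v | s v ≠ 1}.ncard generalizing σ s with
  | zero =>
    rw [Set.ncard_eq_zero, Set.eq_empty_iff_forall_notMem] at hn
    have hs : ∀ v, s v = 1 := fun v => by_contra fun h => hn v h
    have : σ = τ := by
      ext ⟨e, he⟩
      induction e with
      | h a b => rw [h a b he, hs, hs, one_mul, one_mul]
    rw [this]
    exact Relation.ReflTransGen.refl
  | succ n ih =>
    obtain ⟨v, hv⟩ : {v | s v ≠ 1}.Nonempty := by
      rw [← Set.ncard_pos]
      omega
    have hv' : s v = -1 := (Int.units_eq_one_or (s v)).resolve_left hv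
    refine Relation.ReflTransGen.head ⟨v, rfl⟩ (ih _ (Function.update s v 1) ?_ ?_)
    · intro a b hab
      have hne := hab.ne
      simp only [switchAt, Sym2.mem_iff, h a b hab]
      by_cases ha : v = a
      · subst ha
        simp [hne.symm, hv']
      · by_cases hb : v = b
        · subst hb
          simp [hne, hv']
        · simp [ha, hb, Ne.symm ha, Ne.symm hb, Function.update_of_ne]
    · have : {w | Function.update s v 1 w ≠ 1} = {v | s v ≠ 1} \ {v} := by
        ext w
        by_cases hw : w = v
        · simp [hw]
        · simp [hw, Function.update_of_ne]
      rw [this, Set.ncard_sdiff_singleton_of_mem hv, hn, Nat.add_sub_cancel]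

/-- A signature on a forest is balanced. -/
theorem isBalanced_of_forall_not_isCore [Finite V] (σ : Signature G) (h : ∀ X, ¬ G.IsCore X) :
    σ.IsBalanced := by
  classical
  have key : ∀ n (X : Set V), X.ncard = n → ∃ s : V → ℤˣ, ∀ a ∈ X, ∀ b ∈ X, ∀ hab : G.Adj a b,
      σ ⟨s(a, b), hab⟩ = s a * s b := by
    intro n
    induction n with
    | zero =>
      intro X hX
      rw [Set.ncard_eq_zero] at hX
      subst hX
      exact ⟨1, by simp⟩
    | succ n ih =>
      intro X hX
      have hne : X.Nonempty := by
        rw [← Set.ncard_pos]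
        omega
      have hcore := h X
      simp only [SimpleGraph.IsCore, hne, true_and, not_forall] at hcore
      obtain ⟨v, hv, hdeg⟩ := hcore
      push Not at hdeg
      obtain ⟨s, hs⟩ := ih (X \ {v}) (by rw [Set.ncard_sdiff_singleton_of_mem hv]; omega)
      -- `v` has at most one neighbor in `X`, so one sign at `v` meets all its constraints.
      obtain ⟨k, hk⟩ : ∃ k : ℤˣ, ∀ b ∈ X, ∀ hvb : G.Adj v b, σ ⟨s(v, b), hvb⟩ = k * s b := by
        by_cases hb : ∃ b ∈ X, G.Adj v b
        · obtain ⟨b, hb, hvb⟩ := hb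
          refine ⟨σ ⟨s(v, b), hvb⟩ * s b, fun b' hb' hvb' => ?_⟩
          have : b' = b := by_contra fun hne => hdeg b' hb' b hb hne hvb' hvb
          subst this
          rw [mul_assoc, Int.units_mul_self, mul_one]
        · exact ⟨1, fun b hb' hvb => absurd ⟨b, hb', hvb⟩ hb⟩
      refine ⟨Function.update s v k, fun a ha b hb hab => ?_⟩
      by_cases hav : a = v
      · subst hav
        simp [hab.ne', hk b hb hab]
      · by_cases hbv : b = v
        · subst hbv
          have := hk a ha hab.symm
          simp only [Sym2.eq_swap (a := b)] at this
          simp [hav, this, mul_comm]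
        · simp [hav, hbv, hs a ⟨ha, hav⟩ b ⟨hb, hbv⟩ hab]
  obtain ⟨s, hs⟩ := key _ Set.univ rfl
  exact switchingEquivalent_of_eq_mul σ _ s fun a b hab => by
    rw [hs a trivial b trivial hab, mul_one]

end Signature

/-! ### Recognizing the forbidden blocks. -/

namespace SimpleGraph

variable {V : Type*} {G : SimpleGraph V}

theorem Reachable.mem_of_forall_adj {a b : V} (h : G.Reachable a b) {K : Set V} (ha : a ∈ K)
    (hK : ∀ x ∈ K, ∀ y, G.Adj x y → y ∈ K) : b ∈ K := by
  obtain ⟨p⟩ := h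
  induction p with
  | nil => exact ha
  | cons h p ih => exact ih (hK _ ha _ h)

theorem connected_of_radius_le_two {W : Type*} {H : SimpleGraph W} (r : W)
    (h : ∀ v, v = r ∨ H.Adj r v ∨ ∃ m, H.Adj r m ∧ H.Adj m v) : H.Connected := by
  have hr : ∀ v, H.Reachable r v := by
    intro v
    rcases h v with rfl | h | ⟨m, h1, h2⟩
    · rfl
    · exact h.reachable
    · exact h1.reachable.trans h2.reachable
  have : Nonempty W := ⟨r⟩
  exact ⟨fun a b => (hr a).symm.trans (hr b)⟩

/-- The isomorphism from a graph embedded in `G` onto the induced subgraph on its image. -/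
noncomputable def Embedding.isoCoeInduceRange {W : Type*} {H : SimpleGraph W} (e : H ↪g G) :
    H ≃g ((⊤ : G.Subgraph).induce (Set.range e)).coe where
  toEquiv := Equiv.ofInjective e e.injective
  map_rel_iff' := by
    intro a b
    exact ⟨fun h => e.map_adj_iff.1 h.2.2, fun h => ⟨⟨a, rfl⟩, ⟨b, rfl⟩, e.map_adj_iff.2 h⟩⟩

/-- A graph with two-step connections avoiding any given vertex, embedded in `G` in such a way that
at most one vertex has neighbours outside, forms a block. -/
theorem Embedding.isBlock_induce_range {n : ℕ} (hn : 3 ≤ n) {H : SimpleGraph (Fin n)} (e : H ↪g G)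
    (hH : ∃ r, ∀ v, v = r ∨ H.Adj r v ∨ ∃ m, H.Adj r m ∧ H.Adj m v)
    (hH' : ∀ w, ∃ r ≠ w, ∀ v ≠ w, v = r ∨ H.Adj r v ∨ ∃ m ≠ w, H.Adj r m ∧ H.Adj m v)
    (k : Fin n) (hk : ∀ i ≠ k, ∀ w, G.Adj (e i) w → ∃ j, w = e j) :
    IsBlock ((⊤ : G.Subgraph).induce (Set.range e)) := by
  set B := (⊤ : G.Subgraph).induce (Set.range e)
  let c := e.isoCoeInduceRange
  refine ⟨⟨?_, ?_, ?_⟩, ?_⟩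
  · rw [← ENat.card_congr c.toEquiv]
    simpa using hn
  · obtain ⟨r, hr⟩ := hH
    exact c.connected_iff.1 (connected_of_radius_le_two r hr)
  · intro w
    obtain ⟨w, rfl⟩ := c.surjective w
    obtain ⟨r, hrw, hr⟩ := hH' w
    refine connected_of_radius_le_two ⟨c r, fun h => hrw (c.injective h)⟩ ?_
    rintro ⟨v, hv⟩
    obtain ⟨v, rfl⟩ := c.surjective v
    have hvw : v ≠ w := fun h => hv (h ▸ rfl)
    rcases hr v hvw with rfl | h | ⟨m, hm, h1, h2⟩
    · exact Or.inl rfl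
    · exact Or.inr (Or.inl (c.map_adj_iff.2 h))
    · exact Or.inr (Or.inr ⟨⟨c m, fun h => hm (c.injective h)⟩, c.map_adj_iff.2 h1,
        c.map_adj_iff.2 h2⟩)
  · intro K hK hBK
    have hkB : ∀ i, e i ∈ K.verts := fun i => hBK.1 ⟨i, rfl⟩
    have hsub : K.verts ⊆ Set.range e := by
      intro t ht
      by_contra htB
      obtain ⟨i, hik⟩ : ∃ i, i ≠ k := by
        have : Nontrivial (Fin n) := Fin.nontrivial_iff_two_le.2 (by omega)
        exact exists_ne k
      have htk : t ≠ e k := fun h => htB ⟨k, h.symm⟩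
      -- A larger 2-connected subgraph stays connected without `e k`, yet the other image vertices
      -- have no neighbors outside the image.
      have hreach := (hK.2.2 ⟨e k, hkB k⟩).preconnected
        ⟨⟨e i, hkB i⟩, fun h => hik (e.injective (congrArg Subtype.val h))⟩
        ⟨⟨t, ht⟩, fun h => htk (congrArg Subtype.val h)⟩
      refine htB (hreach.mem_of_forall_adj (K := {x | x.1.1 ∈ Set.range e}) ⟨i, rfl⟩ ?_)
      rintro ⟨⟨x, hx⟩, hxk⟩ ⟨j, hj⟩ ⟨⟨y, hy⟩, hyk⟩ hxy
      have hxy' : G.Adj x y := K.adj_sub hxy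
      have hj : e j = x := hj
      subst hj
      obtain ⟨l, hl⟩ := hk j (fun h => hxk (by subst h; rfl)) y hxy'
      exact ⟨l, hl.symm⟩
    refine ⟨hsub, fun a b hab => ?_⟩
    exact ⟨hsub (K.edge_vert hab), hsub (K.edge_vert hab.symm), K.adj_sub hab⟩

end SimpleGraph

namespace SimpleGraph

variable {V : Type*} {G : SimpleGraph V}

theorem K4Bullet_adj {i j : Fin 5} : K4Bullet.Adj i j ↔
    s(i, j) ∈ ({s(0, 2), s(0, 3), s(1, 2), s(1, 3), s(2, 3), s(0, 4), s(4, 1)} :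
      Finset (Sym2 (Fin 5))) := by
  rw [K4Bullet, fromEdgeSet_adj]
  revert i j
  simp only [Set.mem_insert_iff, Set.mem_singleton_iff]
  decide

/-- The embedding given by an injective map that preserves and reflects adjacency. -/
def embeddingOfInjective {W : Type*} {H : SimpleGraph W} (f : W → V) (hf : Function.Injective f)
    (h : ∀ i j, G.Adj (f i) (f j) ↔ H.Adj i j) : H ↪g G :=
  ⟨⟨f, hf⟩, h _ _⟩

theorem ncard_neighborSet_eq_degree [Fintype V] [DecidableRel G.Adj] (v : V) :
    (G.neighborSet v).ncard = G.degree v := by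
  rw [Set.ncard_eq_toFinset_card', ← card_neighborFinset_eq_degree, neighborFinset]

variable [Finite V]

theorem exists_isBlock_cycleGraph_three {a b c : V} (hab : G.Adj a b) (hac : G.Adj a c)
    (hbc : G.Adj b c) (ha : (G.neighborSet a).ncard ≤ 2) (hb : (G.neighborSet b).ncard ≤ 2) :
    ∃ e : cycleGraph 3 ↪g G, (e 0 = a ∧ e 1 = b ∧ e 2 = c) ∧
      IsBlock ((⊤ : G.Subgraph).induce (Set.range e)) := by
  have h1 := hab.ne
  have h2 := hac.ne
  have h3 := hbc.ne
  let e : cycleGraph 3 ↪g G := embeddingOfInjective ![a, b, c]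
    (by
      intro i j
      fin_cases i <;> fin_cases j <;> simp [h1, h2, h3, h1.symm, h2.symm, h3.symm])
    (by
      intro i j
      fin_cases i <;> fin_cases j <;>
        simp [cycleGraph_adj', hab, hac, hbc, hab.symm, hac.symm, hbc.symm] <;> decide)
  refine ⟨e, ⟨rfl, rfl, rfl⟩, e.isBlock_induce_range le_rfl (by decide) (by decide) 2 ?_⟩
  intro i hi w hw
  fin_cases i
  · rcases eq_or_eq_of_adj ha hab hac h3 w hw with rfl | rfl
    exacts [⟨1, rfl⟩, ⟨2, rfl⟩]
  · rcases eq_or_eq_of_adj hb hab.symm hbc h2 w hw with rfl | rfl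
    exacts [⟨0, rfl⟩, ⟨2, rfl⟩]
  · exact absurd rfl hi

theorem exists_isBlock_cycleGraph_four {a b c d : V} (hab : G.Adj a b) (hbc : G.Adj b c)
    (hcd : G.Adj c d) (hda : G.Adj d a) (hac : a ≠ c) (hbd : b ≠ d)
    (ha : (G.neighborSet a).ncard ≤ 2) (hb : (G.neighborSet b).ncard ≤ 2)
    (hc : (G.neighborSet c).ncard ≤ 2) :
    ∃ e : cycleGraph 4 ↪g G, (e 0 = a ∧ e 1 = b ∧ e 2 = c ∧ e 3 = d) ∧
      IsBlock ((⊤ : G.Subgraph).induce (Set.range e)) := by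
  have h1 := hab.ne
  have h2 := hbc.ne
  have h3 := hcd.ne
  have h4 := hda.ne
  have Na := eq_or_eq_of_adj ha hab hda.symm hbd
  have Nb := eq_or_eq_of_adj hb hab.symm hbc hac
  have Nc := eq_or_eq_of_adj hc hbc.symm hcd hbd
  have nac : ¬ G.Adj a c := fun h => (Na c h).elim h2.symm h3
  have nbd : ¬ G.Adj b d := fun h => (Nb d h).elim h4 h3.symm
  have nca : ¬ G.Adj c a := fun h => nac h.symm
  have ndb : ¬ G.Adj d b := fun h => nbd h.symm
  let e : cycleGraph 4 ↪g G := embeddingOfInjective ![a, b, c, d]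
    (by
      intro i j
      fin_cases i <;> fin_cases j <;> simp [h1, h2, h3, h4, hac, hbd, h1.symm, h2.symm, h3.symm,
        h4.symm, hac.symm, hbd.symm])
    (by
      intro i j
      fin_cases i <;> fin_cases j <;> simp [cycleGraph_adj', hab, hbc, hcd, hda, hab.symm,
        hbc.symm, hcd.symm, hda.symm, nac, nbd, nca, ndb] <;> decide)
  refine ⟨e, ⟨rfl, rfl, rfl, rfl⟩, e.isBlock_induce_range (by simp) (by decide) (by decide) 3 ?_⟩
  intro i hi w hw
  fin_cases i
  · rcases Na w hw with rfl | rfl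
    exacts [⟨1, rfl⟩, ⟨3, rfl⟩]
  · rcases Nb w hw with rfl | rfl
    exacts [⟨0, rfl⟩, ⟨2, rfl⟩]
  · rcases Nc w hw with rfl | rfl
    exacts [⟨1, rfl⟩, ⟨3, rfl⟩]
  · exact absurd rfl hi

theorem exists_isBlock_completeGraph_four (h3 : ∀ v, (G.neighborSet v).ncard ≤ 3) {a b c d : V}
    (hab : G.Adj a b) (hac : G.Adj a c) (had : G.Adj a d) (hbc : G.Adj b c) (hbd : G.Adj b d)
    (hcd : G.Adj c d) : ∃ B : G.Subgraph, IsBlock B ∧ Nonempty (B.coe ≃g completeGraph (Fin 4)) := by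
  let e : completeGraph (Fin 4) ↪g G := embeddingOfInjective ![a, b, c, d]
    (by
      intro i j
      fin_cases i <;> fin_cases j <;> simp [hab.ne, hac.ne, had.ne, hbc.ne, hbd.ne, hcd.ne,
        hab.ne', hac.ne', had.ne', hbc.ne', hbd.ne', hcd.ne'])
    (by
      intro i j
      fin_cases i <;> fin_cases j <;> simp [completeGraph, hab, hac, had, hbc, hbd, hcd, hab.symm,
        hac.symm, had.symm, hbc.symm, hbd.symm, hcd.symm])
  refine ⟨_, e.isBlock_induce_range (by simp) ?_ ?_ 3 ?_, ⟨e.isoCoeInduceRange.symm⟩⟩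
  · simp only [completeGraph, top_adj]
    decide
  · simp only [completeGraph, top_adj]
    decide
  · intro i hi w hw
    fin_cases i
    · rcases eq_or_eq_or_eq_of_adj (h3 a) hab hac had hbc.ne hbd.ne hcd.ne w hw with rfl | rfl | rfl
      exacts [⟨1, rfl⟩, ⟨2, rfl⟩, ⟨3, rfl⟩]
    · rcases eq_or_eq_or_eq_of_adj (h3 b) hab.symm hbc hbd hac.ne had.ne hcd.ne w hw with
        rfl | rfl | rfl
      exacts [⟨0, rfl⟩, ⟨2, rfl⟩, ⟨3, rfl⟩]
    · rcases eq_or_eq_or_eq_of_adj (h3 c) hac.symm hbc.symm hcd hab.ne had.ne hbd.ne w hw with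
        rfl | rfl | rfl
      exacts [⟨0, rfl⟩, ⟨1, rfl⟩, ⟨3, rfl⟩]
    · exact absurd rfl hi

theorem exists_isBlock_K4Bullet (h3 : ∀ v, (G.neighborSet v).ncard ≤ 3) {a b c d e : V}
    (h : G.IsK4Bullet a b c d e) (he : (G.neighborSet e).ncard ≤ 2) :
    ∃ B : G.Subgraph, IsBlock B ∧ Nonempty (B.coe ≃g K4Bullet) := by
  obtain ⟨hab, hec, hed, hac, had, hbc, hbd, hcd, hea, heb⟩ := h
  have Na := eq_or_eq_or_eq_of_adj (h3 a) hac had hea.symm hcd.ne hec.symm hed.symm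
  have Nb := eq_or_eq_or_eq_of_adj (h3 b) hbc hbd heb.symm hcd.ne hec.symm hed.symm
  have Nc := eq_or_eq_or_eq_of_adj (h3 c) hac.symm hbc.symm hcd hab had.ne hbd.ne
  have Nd := eq_or_eq_or_eq_of_adj (h3 d) had.symm hbd.symm hcd.symm hab hac.ne hbc.ne
  have Ne := eq_or_eq_of_adj he hea heb hab
  have nab : ¬ G.Adj a b := fun h => by
    rcases Na b h with h | h | h
    exacts [hbc.ne h, hbd.ne h, heb.ne' h]
  have nec : ¬ G.Adj e c := fun h => (Ne c h).elim hac.ne' hbc.ne'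
  have ned : ¬ G.Adj e d := fun h => (Ne d h).elim had.ne' hbd.ne'
  have nba : ¬ G.Adj b a := fun h => nab h.symm
  have nce : ¬ G.Adj c e := fun h => nec h.symm
  have nde : ¬ G.Adj d e := fun h => ned h.symm
  let f : K4Bullet ↪g G := embeddingOfInjective ![a, b, c, d, e]
    (by
      intro i j
      fin_cases i <;> fin_cases j <;> simp [hac.ne, had.ne, hbc.ne, hbd.ne, hcd.ne, hea.ne, heb.ne,
        hac.ne', had.ne', hbc.ne', hbd.ne', hcd.ne', hea.ne', heb.ne', hab, hec, hed, hab.symm,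
        hec.symm, hed.symm])
    (by
      intro i j
      rw [K4Bullet_adj]
      fin_cases i <;> fin_cases j <;> simp [hac, had, hbc, hbd, hcd, hea, heb, hac.symm, had.symm,
        hbc.symm, hbd.symm, hcd.symm, hea.symm, heb.symm, nab, nec, ned, nba, nce, nde])
  refine ⟨_, f.isBlock_induce_range (by simp) ?_ ?_ 4 ?_, ⟨f.isoCoeInduceRange.symm⟩⟩
  · simp only [K4Bullet_adj]
    decide
  · simp only [K4Bullet_adj]
    decide
  · intro i hi w hw
    fin_cases i
    · rcases Na w hw with rfl | rfl | rfl
      exacts [⟨2, rfl⟩, ⟨3, rfl⟩, ⟨4, rfl⟩]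
    · rcases Nb w hw with rfl | rfl | rfl
      exacts [⟨2, rfl⟩, ⟨3, rfl⟩, ⟨4, rfl⟩]
    · rcases Nc w hw with rfl | rfl | rfl
      exacts [⟨0, rfl⟩, ⟨1, rfl⟩, ⟨3, rfl⟩]
    · rcases Nd w hw with rfl | rfl | rfl
      exacts [⟨0, rfl⟩, ⟨1, rfl⟩, ⟨2, rfl⟩]
    · exact absurd rfl hi

end SimpleGraph

/-! ### Derivation of the theorem. -/

theorem theorem1p5 {V : Type*} [Fintype V] [Nontrivial V] (G : SimpleGraph V)
    [DecidableRel G.Adj] (σ : Signature G)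
    (hconn : G.Connected)
    (hcubic : ∀ v, G.degree v ≤ 3)
    (hblock : ∀ B : G.Subgraph, IsBlock B →
      ¬ IsC3Star B ∧ ¬ IsC4Star B ∧
      ¬ Nonempty (B.coe ≃g K4Bullet) ∧
      ¬ Nonempty (B.coe ≃g SimpleGraph.completeGraph (Fin 4))) :
    ∃ f : V → Finset (Fin 5), σ.IsColoring 5 (fun v => 6 - G.degree v) f := by
  classical
  have hdeg := fun v => SimpleGraph.ncard_neighborSet_eq_degree (G := G) v
  have hpos : ∀ v, 0 < G.degree v := fun v =>
    hconn.preconnected.degree_pos_of_nontrivial v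
  have h3 : ∀ v, (G.neighborSet v).ncard ≤ 3 := fun v => (hdeg v).trans_le (hcubic v)
  have h2 : ∀ v ∉ {v | G.degree v = 3}, (G.neighborSet v).ncard ≤ 2 := fun v hv => by
    have hv : G.degree v ≠ 3 := hv
    have := hcubic v
    have := hdeg v
    omega
  have heq : ∀ {v a b}, v ∉ {v | G.degree v = 3} → G.Adj v a → G.Adj v b → a ≠ b →
      G.degree v = 2 := by
    intro v a b hv ha hb hab
    have := h2 v hv
    have hle := Set.ncard_le_ncard (s := {a, b}) (t := G.neighborSet v)
      (by rintro x (rfl | rfl) <;> assumption)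
    rw [Set.ncard_pair hab] at hle
    have := hdeg v
    omega
  have hG : G.Admissible {v | G.degree v = 3} := by
    refine ⟨h3, h2, ?_, ?_, ?_, ?_⟩
    · intro a b c hab hac hbc ha hb
      obtain ⟨e, ⟨e0, e1, -⟩, hB⟩ :=
        SimpleGraph.exists_isBlock_cycleGraph_three hab hac hbc (h2 a ha) (h2 b hb)
      refine (hblock _ hB).1 ⟨e.isoCoeInduceRange, ?_, ?_, hcubic _⟩
      · change G.degree (e 0) = 2
        rw [e0]
        exact heq ha hab hac hbc.ne
      · change G.degree (e 1) = 2
        rw [e1]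
        exact heq hb hab.symm hbc hac.ne
    · intro a b c d hab hbc hcd hda hac hbd ha hb hc _
      obtain ⟨e, ⟨e0, e1, e2, -⟩, hB⟩ := SimpleGraph.exists_isBlock_cycleGraph_four hab hbc hcd hda
        hac hbd (h2 a ha) (h2 b hb) (h2 c hc)
      refine (hblock _ hB).2.1 ⟨e.isoCoeInduceRange, ?_, ?_, ?_, hcubic _⟩
      · change G.degree (e 0) = 2
        rw [e0]
        exact heq ha hab hda.symm hbd
      · change G.degree (e 1) = 2
        rw [e1]
        exact heq hb hab.symm hbc hac
      · change G.degree (e 2) = 2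
        rw [e2]
        exact heq hc hbc.symm hcd hbd
    · intro a b c d h1 h2 h4 h5 h6 h7
      obtain ⟨B, hB, hiso⟩ := SimpleGraph.exists_isBlock_completeGraph_four h3 h1 h2 h4 h5 h6 h7
      exact (hblock B hB).2.2.2 hiso
    · intro a b c d e h
      by_contra he
      obtain ⟨B, hB, hiso⟩ := SimpleGraph.exists_isBlock_K4Bullet h3 h (h2 e he)
      exact (hblock B hB).2.2.1 hiso
  obtain ⟨c, hc2, hc1, hc⟩ := hG.coreColorable.exists_card_eq
  -- A vertex receives the complement of `c v`. Leaves need all five colors and may have them, since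
  -- they lie in no core.
  refine ⟨fun v => if G.degree v = 1 then Finset.univ else (c v)ᶜ, fun v => ?_, fun i => ?_⟩
  · have := hcubic v
    have := hpos v
    dsimp only
    split_ifs with h
    · simp [h]
    · rw [Finset.card_compl, Fintype.card_fin]
      by_cases hv : G.degree v = 3
      · rw [hc2 v hv, hv]
      · rw [hc1 v hv]
        omega
  · refine Signature.isBalanced_of_forall_not_isCore _ fun X hX => ?_
    have hcore : G.IsCore (Subtype.val '' X) := by
      refine ⟨hX.1.image _, ?_⟩
      rintro _ ⟨v, hv, rfl⟩
      obtain ⟨a, ha, b, hb, hab, h1, h2⟩ := hX.2 v hv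
      exact ⟨a, ⟨a, ha, rfl⟩, b, ⟨b, hb, rfl⟩, fun h => hab (Subtype.ext h), h1, h2⟩
    obtain ⟨_, ⟨v, hv, rfl⟩, hi⟩ := hc _ hcore i
    have hvi := v.2
    simp only [Set.mem_ofPred_eq] at hvi
    split_ifs at hvi with h
    · obtain ⟨a, ha, b, hb, hab, h1, h2⟩ := hX.2 v hv
      rw [← hdeg, Set.ncard_eq_one] at h
      obtain ⟨w, hw⟩ := h
      have ha' : (a : V) ∈ G.neighborSet v := h1
      have hb' : (b : V) ∈ G.neighborSet v := h2
      rw [hw] at ha' hb'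
      exact hab (Subtype.ext ((Set.mem_singleton_iff.1 ha').trans (Set.mem_singleton_iff.1 hb').symm))
    · exact Finset.mem_compl.1 hvi hi
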